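/- Let $0<q<1$ and let $\mathcal O(SU_q(2))$ be the unital complex $*$-algebra generated by $a,b,c,d$ with relations $ab=qba$, $ac=qca$, $bd=qdb$, $cd=qdc$, $bc=cb$, $ad-qbc=1=da-q^{-1}bc$, involution $a^*=d$, $b^*=-qc$, $c^*=-q^{-1}b$, $d^*=a$, and the comultiplication $\Delta$ for which $\begin{pmatrix}a&b\\c&d\end{pmatrix}$ is a matrix corepresentation. Let $h$ be its Haar functional ($h(1)=1$, $(\mathrm{id}\otimes h)\Delta f=h(f)1=(h\otimes \mathrm{id})\Delta f$), and let $H$ be the completion of $\mathcal O(SU_q(2))$ for the inner product $\langle y,x\rangle=h(xy^*)$. For $l\in\frac12\mathbb N=\{0,\frac12,1,\dots\}$ let $T^{(l)}=(t^l_{ij})_{-l\le i,j\le l}$ be the irreducible unitary matrix corepresentation on the homogeneous polynomials of degree $2l$ in the quantum plane $xy=qyx$, with coaction $x\mapsto x\otimes a+y\otimes c$, $y\mapsto x\otimes b+y\otimes d$, in the normalized basis $\binom{2l}{l+i}_{q^{-2}}^{1/2}x^{l-i}y^{l+i}$. For $f\in H$ let $\hat f(l)_{mn}=\langle t^l_{nm},f\rangle$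 (that is, $h(f(t^l_{nm})^*)$), and write $[n]_q=\frac{q^n-q^{-n}}{q-q^{-1}}$ and $\mathrm{Tr}_q(A)=\sum_{j=-l}^{l}q^{-2j}A_{jj}$. A symbol $\sigma$ assigns to each $l\in\frac12\mathbb N$ a matrix $\sigma(l)$ of size $2l+1$, indexed by $-l,\dots,l$, with entries in $\mathcal O(SU_q(2))$. Its global pseudo-differential operator is $$T_\sigma f=\sum_{l\in\frac12\mathbb N}[2l+1]_q\,\mathrm{Tr}_q\big(\sigma(l)\,\hat f(l)\,T^{(l)}\big),$$ i.e. the inverse Fourier transform of $\sigma\hat f$, a possibly unbounded operator in $H$ whose domain consists of all $f\in H$ for which the series converges unconditionally in $H$. For $m\in\frac12\mathbb N$, a symbol is homogeneous of Fourier order $m$ if there are maps $\psi(l)$ from pairs of indices in $\{-l,\dots,l\}$ to pairs of half-integers such that $\sigma(l)_{ij}\in\mathbb C\,t^m_{\psi(l)(i,j)}$ if both components of $\psi(l)(i,j)$ lie in $\{-m,-m+1,\dots,m\}$, and $\sigma(l)_{ij}=0$ otherwise; $\Phi^m(SU_q(2))$ is the linear span of these symbols (so $\Phi^0$ consists of the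 symbols with scalar entries). **Theorem.** Let $\lambda:\frac12\mathbb N\to\mathbb C$ and let $\sigma\in\Phi^0(SU_q(2))$ satisfy $\sum_{j}\sigma_{i_0j}(l)=\lambda(l)$ for all $l\in\frac12\mathbb N$ and all $-l\le i_0\le l$. Then $\lambda(l)$ belongs to the spectrum of $T_\sigma$ for every $l\in\frac12\mathbb N$. Furthermore, the multiplicity of $\lambda(l)$ is at least $2l+1$: $\dim\ker(T_\sigma-\lambda(l))\ge 2l+1$. -/

import Mathlib

open scoped TensorProduct ComplexConjugate

namespace SUq2

/-- The deformation parameter: a real number `0 < q < 1`. -/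
abbrev Param : Type := Set.Ioo (0 : ℝ) 1

theorem Param.ne_zero (q : Param) : ((q : ℝ) : ℂ) ≠ 0 := by
  exact_mod_cast q.2.1.ne'

/-- The four generators of the coordinate algebra. -/
inductive Gen
  | a | b | c | d

open FreeAlgebra in
/-- The defining relations of `SU_q(2)`. -/
inductive Rel (q : Param) : FreeAlgebra ℂ Gen → FreeAlgebra ℂ Gen → Prop
  | ab : Rel q (ι ℂ Gen.a * ι ℂ Gen.b) (((q : ℝ) : ℂ) • (ι ℂ Gen.b * ι ℂ Gen.a))
  | ac : Rel q (ι ℂ Gen.a * ι ℂ Gen.c) (((q : ℝ) : ℂ) • (ι ℂ Gen.c * ι ℂ Gen.a))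
  | bd : Rel q (ι ℂ Gen.b * ι ℂ Gen.d) (((q : ℝ) : ℂ) • (ι ℂ Gen.d * ι ℂ Gen.b))
  | cd : Rel q (ι ℂ Gen.c * ι ℂ Gen.d) (((q : ℝ) : ℂ) • (ι ℂ Gen.d * ι ℂ Gen.c))
  | bc : Rel q (ι ℂ Gen.b * ι ℂ Gen.c) (ι ℂ Gen.c * ι ℂ Gen.b)
  | ad : Rel q (ι ℂ Gen.a * ι ℂ Gen.d - ((q : ℝ) : ℂ) • (ι ℂ Gen.b * ι ℂ Gen.c)) 1
  | da : Rel q (ι ℂ Gen.d * ι ℂ Gen.a - ((q : ℝ) : ℂ)⁻¹ • (ι ℂ Gen.b * ι ℂ Gen.c)) 1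

/-- The coordinate algebra of `SU_q(2)`: the complex unital algebra with generators `a, b, c, d`
and the relations `Rel`. -/
def Coord (q : Param) : Type := RingQuot (Rel q)

noncomputable instance (q : Param) : Ring (Coord q) := inferInstanceAs (Ring (RingQuot (Rel q)))

noncomputable instance (q : Param) : Algebra ℂ (Coord q) :=
  inferInstanceAs (Algebra ℂ (RingQuot (Rel q)))

/-- The class of a generator. -/
noncomputable def gen (q : Param) (x : Gen) : Coord q :=
  RingQuot.mkAlgHom ℂ (Rel q) (FreeAlgebra.ι ℂ x)

section Relations
variable (q : Param)

theorem gen_ab : gen q .a * gen q .b = ((q : ℝ) : ℂ) • (gen q .b * gen q .a) := by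
  have := RingQuot.mkAlgHom_rel ℂ (Rel.ab (q := q))
  rw [map_smul, map_mul, map_mul] at this
  exact this
theorem gen_ac : gen q .a * gen q .c = ((q : ℝ) : ℂ) • (gen q .c * gen q .a) := by
  have := RingQuot.mkAlgHom_rel ℂ (Rel.ac (q := q))
  rw [map_smul, map_mul, map_mul] at this
  exact this
theorem gen_bd : gen q .b * gen q .d = ((q : ℝ) : ℂ) • (gen q .d * gen q .b) := by
  have := RingQuot.mkAlgHom_rel ℂ (Rel.bd (q := q))
  rw [map_smul, map_mul, map_mul] at this
  exact this
theorem gen_cd : gen q .c * gen q .d = ((q : ℝ) : ℂ) • (gen q .d * gen q .c) := by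
  have := RingQuot.mkAlgHom_rel ℂ (Rel.cd (q := q))
  rw [map_smul, map_mul, map_mul] at this
  exact this
theorem gen_bc : gen q .b * gen q .c = gen q .c * gen q .b := by
  have := RingQuot.mkAlgHom_rel ℂ (Rel.bc (q := q))
  rw [map_mul, map_mul] at this
  exact this
theorem gen_ad : gen q .a * gen q .d = 1 + ((q : ℝ) : ℂ) • (gen q .b * gen q .c) := by
  have := RingQuot.mkAlgHom_rel ℂ (Rel.ad (q := q))
  rw [map_sub, map_smul, map_mul, map_mul, map_one] at this
  exact sub_eq_iff_eq_add.1 this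
theorem gen_da : gen q .d * gen q .a = 1 + ((q : ℝ) : ℂ)⁻¹ • (gen q .b * gen q .c) := by
  have := RingQuot.mkAlgHom_rel ℂ (Rel.da (q := q))
  rw [map_sub, map_smul, map_mul, map_mul, map_one] at this
  exact sub_eq_iff_eq_add.1 this

end Relations

/-- The relations of `SU_q(2)` for a family of elements of an algebra. -/
structure Satisfies (q : Param) {B : Type*} [Ring B] [Algebra ℂ B] (g : Gen → B) : Prop where
  ab : g .a * g .b = ((q : ℝ) : ℂ) • (g .b * g .a)
  ac : g .a * g .c = ((q : ℝ) : ℂ) • (g .c * g .a)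
  bd : g .b * g .d = ((q : ℝ) : ℂ) • (g .d * g .b)
  cd : g .c * g .d = ((q : ℝ) : ℂ) • (g .d * g .c)
  bc : g .b * g .c = g .c * g .b
  ad : g .a * g .d = 1 + ((q : ℝ) : ℂ) • (g .b * g .c)
  da : g .d * g .a = 1 + ((q : ℝ) : ℂ)⁻¹ • (g .b * g .c)

/-- The universal property of the coordinate algebra. -/
noncomputable def lift (q : Param) {B : Type*} [Ring B] [Algebra ℂ B] (g : Gen → B)
    (hg : Satisfies q g) : Coord q →ₐ[ℂ] B :=
  RingQuot.liftAlgHom ℂ ⟨FreeAlgebra.lift ℂ g, by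
    rintro _ _ (_ | _ | _ | _ | _ | _ | _)
    · simp only [map_mul, map_smul, FreeAlgebra.lift_ι_apply, hg.ab]
    · simp only [map_mul, map_smul, FreeAlgebra.lift_ι_apply, hg.ac]
    · simp only [map_mul, map_smul, FreeAlgebra.lift_ι_apply, hg.bd]
    · simp only [map_mul, map_smul, FreeAlgebra.lift_ι_apply, hg.cd]
    · simp only [map_mul, FreeAlgebra.lift_ι_apply, hg.bc]
    · simp only [map_sub, map_mul, map_smul, map_one, FreeAlgebra.lift_ι_apply, hg.ad,
        add_sub_cancel_right]
    · simp only [map_sub, map_mul, map_smul, map_one, FreeAlgebra.lift_ι_apply, hg.da,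
        add_sub_cancel_right]⟩

@[simp] theorem lift_gen (q : Param) {B : Type*} [Ring B] [Algebra ℂ B] (g : Gen → B)
    (hg : Satisfies q g) (x : Gen) : lift q g hg (gen q x) = g x := by
  unfold lift gen
  exact (RingQuot.liftAlgHom_mkAlgHom_apply ℂ _ _ _).trans (FreeAlgebra.lift_ι_apply _ _)

theorem Coord.induction {q : Param} {P : Coord q → Prop}
    (hC : ∀ z : ℂ, P (algebraMap ℂ _ z)) (hg : ∀ x, P (gen q x))
    (hadd : ∀ f g, P f → P g → P (f + g)) (hmul : ∀ f g, P f → P g → P (f * g))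
    (f : Coord q) : P f := by
  obtain ⟨f, rfl⟩ := RingQuot.mkAlgHom_surjective ℂ (Rel q) f
  induction f using FreeAlgebra.induction with
  | grade0 z => rw [AlgHom.commutes]; exact hC z
  | grade1 x => exact hg x
  | mul f g hf hg' => rw [map_mul]; exact hmul _ _ hf hg'
  | add f g hf hg' => rw [map_add]; exact hadd _ _ hf hg'

/-! The involution: the conjugate-linear anti-multiplicative map with
`a* = d`, `b* = -q c`, `c* = -q⁻¹ b`, `d* = a`. -/

/-- The opposite algebra, with scalars acting through complex conjugation. -/
def ConjOp (q : Param) : Type := (Coord q)ᵐᵒᵖ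

noncomputable instance (q : Param) : Ring (ConjOp q) := inferInstanceAs (Ring (Coord q)ᵐᵒᵖ)

noncomputable instance (q : Param) : Algebra ℂ (ConjOp q) :=
  ((algebraMap ℂ (Coord q)ᵐᵒᵖ).comp (starRingEnd ℂ)).toAlgebra' fun z x =>
    Algebra.commutes (A := (Coord q)ᵐᵒᵖ) (conj z) x

/-- Identity map to `ConjOp`. -/
def toConjOp {q : Param} (f : Coord q) : ConjOp q := MulOpposite.op f

/-- Identity map from `ConjOp`. -/
def ofConjOp {q : Param} (f : ConjOp q) : Coord q := MulOpposite.unop f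

theorem ofConjOp_toConjOp {q : Param} (f : Coord q) : ofConjOp (toConjOp f) = f := rfl
theorem ofConjOp_injective {q : Param} : Function.Injective (ofConjOp (q := q)) :=
  MulOpposite.unop_injective
theorem ofConjOp_mul {q : Param} (f g : ConjOp q) : ofConjOp (f * g) = ofConjOp g * ofConjOp f :=
  rfl
theorem ofConjOp_add {q : Param} (f g : ConjOp q) : ofConjOp (f + g) = ofConjOp f + ofConjOp g :=
  rfl
theorem ofConjOp_one {q : Param} : ofConjOp (1 : ConjOp q) = 1 := rfl
theorem ofConjOp_algebraMap {q : Param} (z : ℂ) :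
    ofConjOp (algebraMap ℂ (ConjOp q) z) = algebraMap ℂ (Coord q) (conj z) := rfl
theorem ofConjOp_smul {q : Param} (z : ℂ) (f : ConjOp q) :
    ofConjOp (z • f) = conj z • ofConjOp f := by
  rw [Algebra.smul_def, ofConjOp_mul, ofConjOp_algebraMap, ← Algebra.commutes, Algebra.smul_def]

/-- The adjoints of the generators. -/
noncomputable def genStar (q : Param) : Gen → Coord q
  | .a => gen q .d
  | .b => -((q : ℝ) : ℂ) • gen q .c
  | .c => -((q : ℝ) : ℂ)⁻¹ • gen q .b
  | .d => gen q .a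

/-- The involution, as a homomorphism to `ConjOp`. -/
noncomputable def starHom (q : Param) : Coord q →ₐ[ℂ] ConjOp q :=
  lift q (fun x => toConjOp (genStar q x)) <| by
    have h0 := Param.ne_zero q
    constructor <;> apply ofConjOp_injective <;>
      simp only [ofConjOp_smul, ofConjOp_mul, ofConjOp_add, ofConjOp_toConjOp, ofConjOp_one,
        genStar, smul_mul_assoc, mul_smul_comm, Complex.conj_ofReal, map_inv₀]
    · rw [gen_cd]; module
    · rw [gen_bd]; module
    · rw [gen_ac]; module
    · rw [gen_ab]; module
    · rw [gen_bc]; module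
    · rw [gen_ad, gen_bc]; match_scalars <;> field_simp
    · rw [gen_da, gen_bc]; match_scalars <;> field_simp

noncomputable instance (q : Param) : Star (Coord q) := ⟨fun f => ofConjOp (starHom q f)⟩

theorem star_def {q : Param} (f : Coord q) : star f = ofConjOp (starHom q f) := rfl

theorem star_gen (q : Param) (x : Gen) : star (gen q x) = genStar q x := by
  rw [star_def, starHom, lift_gen]; rfl

theorem star_algebraMap {q : Param} (z : ℂ) :
    star (algebraMap ℂ (Coord q) z) = algebraMap ℂ (Coord q) (conj z) := by
  rw [star_def, AlgHom.commutes]; rfl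

theorem star_smul' {q : Param} (z : ℂ) (f : Coord q) : star (z • f) = conj z • star f := by
  rw [star_def, map_smul, ofConjOp_smul]; rfl

noncomputable instance (q : Param) : StarRing (Coord q) where
  star_mul f g := by rw [star_def, map_mul]; rfl
  star_add f g := by rw [star_def, map_add]; rfl
  star_involutive f := by
    have hmul : ∀ f g : Coord q, star (f * g) = star g * star f := fun f g => by
      rw [star_def, map_mul]; rfl
    have hadd : ∀ f g : Coord q, star (f + g) = star f + star g := fun f g => by
      rw [star_def, map_add]; rfl
    have h0 := Param.ne_zero q
    induction f using Coord.induction with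
    | hC z => simp [star_algebraMap]
    | hg x =>
      have hneg : ∀ (z : ℂ) (x : Gen), star (-z • gen q x) = conj (-z) • genStar q x := fun z x => by
        rw [star_smul', star_gen]
      cases x <;> simp only [star_gen, genStar, hneg] <;>
        simp only [map_neg, map_inv₀, Complex.conj_ofReal, smul_smul] <;>
        match_scalars <;> field_simp
    | hadd f g hf hg => rw [hadd, hadd, hf, hg]
    | hmul f g hf hg => rw [hmul, hmul, hf, hg]

instance (q : Param) : StarModule ℂ (Coord q) := ⟨fun z f => star_smul' z f⟩

/-- The comultiplication, `Δ(t) = t ⊗ t` for the matrix `t = (a b; c d)`. -/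
noncomputable def comul (q : Param) : Coord q →ₐ[ℂ] Coord q ⊗[ℂ] Coord q :=
  lift q (fun
    | .a => gen q .a ⊗ₜ gen q .a + gen q .b ⊗ₜ gen q .c
    | .b => gen q .a ⊗ₜ gen q .b + gen q .b ⊗ₜ gen q .d
    | .c => gen q .c ⊗ₜ gen q .a + gen q .d ⊗ₜ gen q .c
    | .d => gen q .c ⊗ₜ gen q .b + gen q .d ⊗ₜ gen q .d) <| by
    have h0 := Param.ne_zero q
    constructor <;>
      simp only [mul_add, add_mul, Algebra.TensorProduct.tmul_mul_tmul, gen_ab, gen_ac, gen_bd,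
        gen_cd, gen_ad, gen_da, gen_bc, TensorProduct.tmul_add, TensorProduct.add_tmul,
        TensorProduct.tmul_smul, ← TensorProduct.smul_tmul', smul_add, smul_smul,
        Algebra.TensorProduct.one_def] <;>
      match_scalars <;> (try field_simp)



/-! The Haar state, through the faithful representation on the basis `e (n, k)`, `n ∈ ℕ`, `k ∈ ℤ`,
`a e(n,k) = √(1 - q^(2n)) e(n-1,k)`, `c e(n,k) = q^n e(n,k+1)`, and their adjoints
`d = a*`, `b = -q c*`. -/

/-- The weighted shift `e x ↦ w x • e (s x)`. -/
noncomputable def wshift (s : ℕ × ℤ → ℕ × ℤ) (w : ℕ × ℤ → ℂ) : Module.End ℂ (ℕ × ℤ →₀ ℂ) :=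
  Finsupp.linearCombination ℂ fun x => Finsupp.single (s x) (w x)

theorem wshift_single (s : ℕ × ℤ → ℕ × ℤ) (w : ℕ × ℤ → ℂ) (x : ℕ × ℤ) (z : ℂ) :
    wshift s w (Finsupp.single x z) = Finsupp.single (s x) (z * w x) := by
  simp [wshift]

/-- The coefficient `√(1 - q^(2n))`. -/
noncomputable def rt (q : Param) (n : ℕ) : ℂ := ((√(1 - (q : ℝ) ^ (2 * n)) : ℝ) : ℂ)

theorem rt_arg_nonneg (q : Param) (n : ℕ) : 0 ≤ 1 - (q : ℝ) ^ (2 * n) :=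
  sub_nonneg.2 (pow_le_one₀ q.2.1.le q.2.2.le)

theorem rt_mul_self (q : Param) (n : ℕ) : rt q n * rt q n = 1 - ((q : ℝ) : ℂ) ^ (2 * n) := by
  unfold rt
  rw [← Complex.ofReal_mul, Real.mul_self_sqrt (rt_arg_nonneg q n)]
  push_cast; ring

theorem rt_zero (q : Param) : rt q 0 = 0 := by simp [rt]

theorem norm_rt_le (q : Param) (n : ℕ) : ‖rt q n‖ ≤ 1 := by
  unfold rt
  rw [Complex.norm_real, Real.norm_of_nonneg (Real.sqrt_nonneg _)]
  refine Real.sqrt_le_one.2 ?_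
  have : 0 ≤ (q : ℝ) ^ (2 * n) := pow_nonneg q.2.1.le _
  linarith

theorem conj_rt (q : Param) (n : ℕ) : conj (rt q n) = rt q n := Complex.conj_ofReal _

/-- The representation on generators. -/
noncomputable def repGen (q : Param) : Gen → Module.End ℂ (ℕ × ℤ →₀ ℂ)
  | .a => wshift (fun x => (x.1 - 1, x.2)) (fun x => rt q x.1)
  | .b => wshift (fun x => (x.1, x.2 - 1)) (fun x => -((q : ℝ) : ℂ) ^ (x.1 + 1))
  | .c => wshift (fun x => (x.1, x.2 + 1)) (fun x => ((q : ℝ) : ℂ) ^ x.1)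
  | .d => wshift (fun x => (x.1 + 1, x.2)) (fun x => rt q (x.1 + 1))

theorem repGen_satisfies (q : Param) : Satisfies q (repGen q) := by
  have h0 := Param.ne_zero q
  constructor <;> refine Finsupp.lhom_ext fun ⟨n, k⟩ z => ?_ <;>
    simp only [repGen, Module.End.mul_apply, wshift_single, LinearMap.smul_apply,
      LinearMap.add_apply, Module.End.one_apply, Finsupp.smul_single, smul_eq_mul,
      Nat.add_sub_cancel, sub_add_cancel, add_sub_cancel_right, ← Finsupp.single_add]
  · cases n with
    | zero => simp [rt_zero]
    | succ n => congr 1; simp only [Nat.add_sub_cancel]; ring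
  · cases n with
    | zero => simp [rt_zero]
    | succ n => congr 1; simp only [Nat.add_sub_cancel]; ring
  · congr 1; ring
  · congr 1; ring
  · congr 1; ring
  · congr 1
    rw [mul_assoc, rt_mul_self]; ring
  · cases n with
    | zero =>
      rw [rt_zero, mul_zero, zero_mul, Finsupp.single_zero, eq_comm, Finsupp.single_eq_zero]
      field_simp; ring
    | succ n =>
      simp only [Nat.add_sub_cancel]
      congr 1
      rw [mul_assoc, rt_mul_self]; field_simp; ring

/-- The representation of the coordinate algebra. -/
noncomputable def rep (q : Param) : Coord q →ₐ[ℂ] Module.End ℂ (ℕ × ℤ →₀ ℂ) :=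
  lift q (repGen q) (repGen_satisfies q)

/-- The matrix entries `⟨π(f) e_x, e_y⟩` of the representation. -/
noncomputable def entry (q : Param) (f : Coord q) (y x : ℕ × ℤ) : ℂ :=
  rep q f (Finsupp.single x 1) y

section Entry
variable {q : Param}

theorem entry_add (f g : Coord q) (y x : ℕ × ℤ) :
    entry q (f + g) y x = entry q f y x + entry q g y x := by simp [entry]

theorem entry_smul (z : ℂ) (f : Coord q) (y x : ℕ × ℤ) :
    entry q (z • f) y x = z * entry q f y x := by simp [entry]

theorem entry_algebraMap (z : ℂ) (y x : ℕ × ℤ) :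
    entry q (algebraMap ℂ _ z) y x = if x = y then z else 0 := by
  simp [entry, Module.algebraMap_end_apply, Finsupp.single_apply]

theorem rep_apply_eq_sum (f : Coord q) (v : ℕ × ℤ →₀ ℂ) (y : ℕ × ℤ) {S : Finset (ℕ × ℤ)}
    (hS : v.support ⊆ S) : rep q f v y = ∑ z ∈ S, entry q f y z * v z := by
  have : v = ∑ z ∈ S, v z • Finsupp.single z 1 := by
    conv_lhs => rw [← Finsupp.sum_single v, Finsupp.sum_of_support_subset v hS _ (by simp)]
    simp
  conv_lhs => rw [this]
  rw [map_sum, Finsupp.finsetSum_apply]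
  refine Finset.sum_congr rfl fun z _ => ?_
  rw [map_smul, Finsupp.smul_apply, smul_eq_mul, mul_comm, entry]

theorem entry_mul (f g : Coord q) (y x : ℕ × ℤ) {S : Finset (ℕ × ℤ)}
    (hS : (rep q g (Finsupp.single x 1)).support ⊆ S) :
    entry q (f * g) y x = ∑ z ∈ S, entry q f y z * entry q g z x := by
  conv_lhs => rw [entry, map_mul, Module.End.mul_apply, rep_apply_eq_sum f _ y hS]
  rfl

theorem entry_gen (x : Gen) (y p : ℕ × ℤ) :
    entry q (gen q x) y p = repGen q x (Finsupp.single p 1) y := by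
  simp [entry, rep]

theorem entry_star (f : Coord q) : ∀ y x, entry q (star f) y x = conj (entry q f x y) := by
  induction f using Coord.induction with
  | hC z =>
    intro y x
    rw [star_algebraMap, entry_algebraMap, entry_algebraMap]
    by_cases h : x = y
    · rw [if_pos h, if_pos h.symm]
    · rw [if_neg h, if_neg (Ne.symm h), map_zero]
  | hg g =>
    have key : ∀ (s t : ℕ × ℤ → ℕ × ℤ) (w u : ℕ × ℤ → ℂ),
        (∀ x y, (if s x = y then w x else 0) = conj (if t y = x then u y else 0)) →
        ∀ y x, wshift s w (Finsupp.single x 1) y = conj (wshift t u (Finsupp.single y 1) x) := by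
      intro s t w u h y x
      simp only [wshift_single, one_mul, Finsupp.single_apply]
      exact h x y
    have had : ∀ y x, repGen q .d (Finsupp.single x 1) y
        = conj (repGen q .a (Finsupp.single y 1) x) := by
      refine key _ _ _ _ ?_
      rintro ⟨n, k⟩ ⟨m, l⟩
      rcases m with _ | m
      · simp [rt_zero]
      · by_cases h : n = m ∧ k = l
        · obtain ⟨rfl, rfl⟩ := h; simp [conj_rt]
        · rw [if_neg, if_neg]
          · simp
          · simp only [Nat.add_sub_cancel, Prod.mk.injEq]; tauto
          · simp only [Prod.mk.injEq, add_left_inj]; tauto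
    have hbc : ∀ y x, (-((q : ℝ) : ℂ) • repGen q .c) (Finsupp.single x 1) y
        = conj (repGen q .b (Finsupp.single y 1) x) := by
      intro y x
      have := key (fun x => (x.1, x.2 + 1)) (fun x => (x.1, x.2 - 1))
        (fun x => ((q : ℝ) : ℂ) ^ x.1 * -((q : ℝ) : ℂ)) (fun x => -((q : ℝ) : ℂ) ^ (x.1 + 1)) ?_ y x
      · rw [repGen, repGen, ← this, LinearMap.smul_apply, wshift_single, wshift_single,
          Finsupp.smul_single, smul_eq_mul]
        congr 2; ring
      · rintro ⟨n, k⟩ ⟨m, l⟩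
        by_cases h : n = m ∧ k + 1 = l
        · obtain ⟨rfl, rfl⟩ := h
          simp [Complex.conj_ofReal]; ring
        · rw [if_neg, if_neg]
          · simp
          · simp only [Prod.mk.injEq]; intro h'; apply h; omega
          · simp only [Prod.mk.injEq]; exact h
    intro y x
    have h0 := Param.ne_zero q
    cases g with
    | a => rw [star_gen, genStar, entry_gen, entry_gen]; exact had y x
    | d =>
      rw [star_gen, genStar, entry_gen, entry_gen, had x y, Complex.conj_conj]
    | b => rw [star_gen, genStar, entry_smul, entry_gen, entry_gen]; exact hbc y x
    | c =>
      rw [star_gen, genStar, entry_smul, entry_gen, entry_gen]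
      have := hbc x y
      rw [← Complex.conj_conj (repGen q .b (Finsupp.single x 1) y), ← this]
      simp [Complex.conj_ofReal, h0]
  | hadd f g hf hg => intro y x; rw [star_add, entry_add, entry_add, hf, hg, map_add]
  | hmul f g hf hg =>
    classical
    intro y x
    rw [star_mul, entry_mul _ _ _ _ Finset.subset_union_left,
      entry_mul f g x y (Finset.subset_union_right
        (s₁ := (rep q (star f) (Finsupp.single x 1)).support)), map_sum]
    refine Finset.sum_congr rfl fun z _ => ?_
    rw [hf, hg, map_mul, mul_comm]

open scoped ENNReal in
theorem entry_bounded (f : Coord q) :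
    ∃ C : NNReal, ∀ x, ∑' y, ‖entry q f y x‖ₑ ≤ C := by
  have hsingle : ∀ (x : ℕ × ℤ) (z : ℂ), ∑' y, ‖Finsupp.single x z y‖ₑ = ‖z‖ₑ := by
    intro x z
    rw [tsum_eq_single x]
    · simp
    · intro y hy; simp [hy.symm]
  induction f using Coord.induction with
  | hC z =>
    refine ⟨‖z‖₊, fun x => ?_⟩
    rw [tsum_eq_single x]
    · simp [entry_algebraMap, enorm]
    · intro y hy; simp [entry_algebraMap, hy.symm]
  | hg g =>
    have hq : ∀ n : ℕ, ‖((q : ℝ) : ℂ) ^ n‖ ≤ 1 := fun n => by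
      rw [norm_pow, Complex.norm_real, Real.norm_of_nonneg q.2.1.le]
      exact pow_le_one₀ q.2.1.le q.2.2.le
    refine ⟨1, fun x => ?_⟩
    simp only [entry_gen]
    cases g <;> simp only [repGen, wshift_single, hsingle, one_mul] <;>
      rw [enorm_le_coe, ← NNReal.coe_le_coe, coe_nnnorm, NNReal.coe_one]
    · exact norm_rt_le _ _
    · rw [norm_neg]; exact hq _
    · exact hq _
    · exact norm_rt_le _ _
  | hadd f g hf hg =>
    obtain ⟨C, hC⟩ := hf
    obtain ⟨D, hD⟩ := hg
    refine ⟨C + D, fun x => ?_⟩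
    calc ∑' y, ‖entry q (f + g) y x‖ₑ
        ≤ ∑' y, (‖entry q f y x‖ₑ + ‖entry q g y x‖ₑ) :=
          ENNReal.tsum_le_tsum fun y => by rw [entry_add]; exact enorm_add_le _ _
      _ ≤ (C + D : NNReal) := by
          rw [ENNReal.tsum_add, ENNReal.coe_add]; exact add_le_add (hC x) (hD x)
  | hmul f g hf hg =>
    obtain ⟨C, hC⟩ := hf
    obtain ⟨D, hD⟩ := hg
    refine ⟨C * D, fun x => ?_⟩
    calc ∑' y, ‖entry q (f * g) y x‖ₑ
        ≤ ∑' y, ∑' z, ‖entry q f y z‖ₑ * ‖entry q g z x‖ₑ := by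
          refine ENNReal.tsum_le_tsum fun y => ?_
          rw [entry_mul f g y x subset_rfl]
          refine (enorm_sum_le _ _).trans ?_
          simp only [enorm_mul]
          exact ENNReal.sum_le_tsum _
      _ = ∑' z, (∑' y, ‖entry q f y z‖ₑ) * ‖entry q g z x‖ₑ := by
          rw [ENNReal.tsum_comm]; simp only [ENNReal.tsum_mul_right]
      _ ≤ ∑' z, C * ‖entry q g z x‖ₑ :=
          ENNReal.tsum_le_tsum fun z => mul_le_mul_left (hC z) _
      _ ≤ (C * D : NNReal) := by
          rw [ENNReal.tsum_mul_left, ENNReal.coe_mul]; exact mul_le_mul_right (hD x) _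

theorem haar_summable (f : Coord q) :
    Summable fun n : ℕ => ((q : ℝ) : ℂ) ^ (2 * n) * entry q f (n, 0) (n, 0) := by
  obtain ⟨C, hC⟩ := entry_bounded f
  have hgeo : Summable fun n : ℕ => ((q : ℝ) ^ 2) ^ n * (C : ℝ) :=
    (summable_geometric_of_lt_one (sq_nonneg _)
      (pow_lt_one₀ q.2.1.le q.2.2 two_ne_zero)).mul_right _
  refine Summable.of_norm_bounded hgeo fun n => ?_
  rw [norm_mul, norm_pow, Complex.norm_real, Real.norm_of_nonneg q.2.1.le, pow_mul]
  refine mul_le_mul_of_nonneg_left ?_ (by positivity)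
  have := (ENNReal.le_tsum (n, (0 : ℤ))).trans (hC (n, 0))
  rw [enorm_le_coe] at this
  exact_mod_cast this

end Entry

/-- The Haar functional of `SU_q(2)`,
`h(f) = (1 - q²) ∑ₙ q^(2n) ⟨π(f) e(n,0), e(n,0)⟩`. -/
noncomputable def haar (q : Param) : Coord q →ₗ[ℂ] ℂ where
  toFun f := (1 - ((q : ℝ) : ℂ) ^ 2) * ∑' n : ℕ, ((q : ℝ) : ℂ) ^ (2 * n) * entry q f (n, 0) (n, 0)
  map_add' f g := by
    rw [← mul_add, ← (haar_summable f).tsum_add (haar_summable g)]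
    simp only [entry_add, mul_add]
  map_smul' z f := by
    simp only [entry_smul, RingHom.id_apply, smul_eq_mul, mul_left_comm _ z, tsum_mul_left]

theorem haar_apply (q : Param) (f : Coord q) : haar q f =
    (1 - ((q : ℝ) : ℂ) ^ 2) * ∑' n : ℕ, ((q : ℝ) : ℂ) ^ (2 * n) * entry q f (n, 0) (n, 0) := rfl

theorem haar_one (q : Param) : haar q 1 = 1 := by
  have h1 : ‖((q : ℝ) : ℂ) ^ 2‖ < 1 := by
    rw [norm_pow, Complex.norm_real, Real.norm_of_nonneg q.2.1.le]
    exact pow_lt_one₀ q.2.1.le q.2.2 two_ne_zero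
  have h2 : (1 : ℂ) - ((q : ℝ) : ℂ) ^ 2 ≠ 0 := by
    intro h
    rw [← sub_eq_zero.1 h] at h1
    simp at h1
  rw [haar_apply, ← map_one (algebraMap ℂ (Coord q))]
  simp only [entry_algebraMap, if_true, mul_one, pow_mul]
  rw [tsum_geometric_of_norm_lt_one h1, mul_inv_cancel₀ h2]

theorem haar_star (q : Param) (f : Coord q) : haar q (star f) = conj (haar q f) := by
  rw [haar_apply, haar_apply, map_mul, Complex.conj_tsum]
  simp [entry_star, Complex.conj_ofReal]

theorem haar_mul_star_nonneg (q : Param) (f : Coord q) : 0 ≤ (haar q (f * star f)).re := by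
  have : ∀ n : ℕ, ∃ r : ℝ, 0 ≤ r ∧ ((q : ℝ) : ℂ) ^ (2 * n) * entry q (f * star f) (n, 0) (n, 0)
      = (r : ℂ) := by
    intro n
    refine ⟨(q : ℝ) ^ (2 * n) * ∑ z ∈ (rep q (star f) (Finsupp.single (n, 0) 1)).support,
      ‖entry q f (n, 0) z‖ ^ 2, mul_nonneg (pow_nonneg q.2.1.le _)
        (Finset.sum_nonneg fun _ _ => sq_nonneg _), ?_⟩
    rw [entry_mul f (star f) _ _ subset_rfl]
    push_cast
    congr 1
    refine Finset.sum_congr rfl fun z _ => ?_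
    rw [entry_star, Complex.mul_conj, Complex.normSq_eq_norm_sq]
    push_cast; rfl
  choose r hr hr' using this
  rw [haar_apply]
  simp only [hr']
  rw [← Complex.ofReal_tsum, ← Complex.ofReal_pow, ← Complex.ofReal_one, ← Complex.ofReal_sub,
    ← Complex.ofReal_mul, Complex.ofReal_re]
  exact mul_nonneg (sub_nonneg.2 (pow_le_one₀ q.2.1.le q.2.2.le)) (tsum_nonneg hr)


/-! ### Invariance of the Haar functional -/

section Invariance
variable (q : Param)

/-- Invariance of a functional: `(id ⊗ h)(Δ f) = h(f) 1 = (h ⊗ id)(Δ f)` for all `f`. -/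
def IsHaarFunctional {q : Param} (h : Coord q →ₗ[ℂ] ℂ) : Prop :=
  ∀ f : Coord q,
    TensorProduct.rid ℂ (Coord q) (LinearMap.lTensor (Coord q) h (comul q f)) = h f • 1 ∧
    TensorProduct.lid ℂ (Coord q) (LinearMap.rTensor (Coord q) h (comul q f)) = h f • 1

theorem entry_twist {q : Param} (φ : Coord q →ₐ[ℂ] Coord q) (e : ℕ × ℤ ≃ ℕ × ℤ) (u : ℕ × ℤ → ℂ)
    (hφ : ∀ g y x, entry q (φ (gen q g)) y x * u y = u x * entry q (gen q g) (e y) (e x))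
    (f : Coord q) : ∀ y x, entry q (φ f) y x * u y = u x * entry q f (e y) (e x) := by
  classical
  induction f using Coord.induction with
  | hC z =>
    intro y x
    rw [AlgHom.commutes, entry_algebraMap, entry_algebraMap]
    by_cases h : x = y
    · subst h; simp [mul_comm]
    · simp [h]
  | hg g => exact hφ g
  | hadd f g hf hg => intro y x; rw [map_add, entry_add, entry_add, add_mul, mul_add, hf, hg]
  | hmul f g hf hg =>
    intro y x
    set S := (rep q (φ g) (Finsupp.single x 1)).support ∪
      (rep q g (Finsupp.single (e x) 1)).support.map e.symm.toEmbedding with hS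
    have h2 : (rep q g (Finsupp.single (e x) 1)).support ⊆ S.map e.toEmbedding := by
      intro z hz
      rw [Finset.mem_map_equiv, hS, Finset.mem_union]
      right
      rw [Finset.mem_map_equiv]; simpa using hz
    rw [map_mul, entry_mul _ _ _ _ (S := S) Finset.subset_union_left, entry_mul f g _ _ h2,
      Finset.sum_map, Finset.sum_mul, Finset.mul_sum]
    refine Finset.sum_congr rfl fun z _ => ?_
    have h3 := hf y z
    have h4 := hg z x
    simp only [Equiv.coe_toEmbedding]
    linear_combination (entry q (φ g) z x) * h3 + (entry q f (e y) (e z)) * h4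

theorem haar_twist {q : Param} (φ : Coord q →ₐ[ℂ] Coord q) (e : ℕ × ℤ ≃ ℕ × ℤ) (u : ℕ × ℤ → ℂ)
    (hφ : ∀ g y x, entry q (φ (gen q g)) y x * u y = u x * entry q (gen q g) (e y) (e x))
    (he : ∀ n, e (n, 0) = (n, 0)) (hu : ∀ x, u x ≠ 0) (f : Coord q) :
    haar q (φ f) = haar q f := by
  rw [haar_apply, haar_apply]
  congr 2; ext n
  have := entry_twist φ e u hφ f (n, 0) (n, 0)
  rw [he, mul_comm] at this
  rw [mul_left_cancel₀ (hu _) this]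

/-- The torus automorphism used in the proof of invariance. -/
noncomputable def kAut : Coord q →ₐ[ℂ] Coord q :=
  lift q (fun
    | .a => ((q : ℝ) : ℂ) • gen q .a
    | .b => ((q : ℝ) : ℂ)⁻¹ • gen q .b
    | .c => ((q : ℝ) : ℂ) • gen q .c
    | .d => ((q : ℝ) : ℂ)⁻¹ • gen q .d) <| by
    have h0 := Param.ne_zero q
    constructor <;> simp only [smul_mul_assoc, mul_smul_comm, gen_ab, gen_ac, gen_bd,
      gen_cd, gen_ad, gen_da, gen_bc] <;> match_scalars <;> field_simp

theorem haar_kAut (f : Coord q) : haar q (kAut q f) = haar q f := by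
  have h0 := Param.ne_zero q
  refine haar_twist (kAut q) (Equiv.refl _) (fun x => ((q : ℝ) : ℂ) ^ ((x.1 : ℤ) - x.2)) ?_
    (fun _ => rfl) (fun _ => zpow_ne_zero _ h0) f
  rintro g ⟨n, k⟩ ⟨m, l⟩
  cases g <;> simp only [kAut, lift_gen, entry_smul, entry_gen, repGen, wshift_single, one_mul,
    Finsupp.single_apply, Equiv.refl_apply, Prod.mk.injEq]
  · rcases m with _ | m
    · simp [rt_zero]
    · simp only [Nat.add_sub_cancel]
      by_cases h : m = n ∧ l = k
      · obtain ⟨rfl, rfl⟩ := h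
        simp only [true_and, if_true]
        push_cast
        rw [show (m : ℤ) + 1 - l = (m - l) + 1 by ring, zpow_add_one₀ h0]; ring
      · simp [h]
  · by_cases h : m = n ∧ l - 1 = k
    · obtain ⟨rfl, rfl⟩ := h
      simp only [true_and, if_true]
      rw [show (m : ℤ) - (l - 1) = (m - l) + 1 by ring, zpow_add_one₀ h0]; field_simp
    · simp [h]
  · by_cases h : m = n ∧ l + 1 = k
    · obtain ⟨rfl, rfl⟩ := h
      simp only [true_and, if_true]
      rw [show (m : ℤ) - l = (m - (l + 1)) + 1 by ring, zpow_add_one₀ h0]; ring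
    · simp [h]
  · by_cases h : m + 1 = n ∧ l = k
    · obtain ⟨rfl, rfl⟩ := h
      simp only [true_and, if_true]
      push_cast
      rw [show (m : ℤ) + 1 - l = (m - l) + 1 by ring, zpow_add_one₀ h0]; field_simp
    · simp [h]

/-- The automorphism exchanging `b` and `c`. -/
noncomputable def flipAut : Coord q →ₐ[ℂ] Coord q :=
  lift q (fun
    | .a => gen q .a
    | .b => gen q .c
    | .c => gen q .b
    | .d => gen q .d) <| by
    constructor <;> simp only [gen_ab, gen_ac, gen_bd, gen_cd, gen_ad, gen_da, gen_bc]

theorem haar_flipAut (f : Coord q) : haar q (flipAut q f) = haar q f := by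
  have h0 := Param.ne_zero q
  have h1 : -((q : ℝ) : ℂ) ≠ 0 := neg_ne_zero.2 h0
  refine haar_twist (flipAut q) ((Equiv.refl ℕ).prodCongr (Equiv.neg ℤ))
    (fun x => (-((q : ℝ) : ℂ)) ^ x.2) ?_ (fun _ => rfl) (fun _ => zpow_ne_zero _ h1) f
  rintro g ⟨n, k⟩ ⟨m, l⟩
  cases g <;> simp only [flipAut, lift_gen, entry_gen, repGen, wshift_single, one_mul,
    Finsupp.single_apply, Equiv.prodCongr_apply, Prod.map, Equiv.refl_apply, Equiv.neg_apply,
    Prod.mk.injEq, neg_inj]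
  · by_cases h : m - 1 = n ∧ l = k
    · obtain ⟨rfl, rfl⟩ := h; simp [mul_comm]
    · simp [h]
  · by_cases h : m = n ∧ l + 1 = k
    · obtain ⟨rfl, rfl⟩ := h
      rw [if_pos ⟨rfl, rfl⟩, if_pos ⟨rfl, by ring⟩, zpow_add_one₀ h1]; ring
    · rw [if_neg h, if_neg (fun h' => h ⟨h'.1, by have := h'.2; omega⟩)]; simp
  · by_cases h : m = n ∧ l - 1 = k
    · obtain ⟨rfl, rfl⟩ := h
      rw [if_pos ⟨rfl, rfl⟩, if_pos ⟨rfl, by ring⟩, zpow_sub_one₀ h1]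
      field_simp; ring
    · rw [if_neg h, if_neg (fun h' => h ⟨h'.1, by have := h'.2; omega⟩)]; simp
  · by_cases h : m + 1 = n ∧ l = k
    · obtain ⟨rfl, rfl⟩ := h; simp [mul_comm]
    · simp [h]

/-- `f ↦ (k(f), E(f); 0, f)`, for a twisted derivation `E` with `E a = b`, `E c = d`. -/
noncomputable def derivHom : Coord q →ₐ[ℂ] Matrix (Fin 2) (Fin 2) (Coord q) :=
  lift q (fun
    | .a => !![((q : ℝ) : ℂ) • gen q .a, gen q .b; 0, gen q .a]
    | .b => !![((q : ℝ) : ℂ)⁻¹ • gen q .b, 0; 0, gen q .b]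
    | .c => !![((q : ℝ) : ℂ) • gen q .c, gen q .d; 0, gen q .c]
    | .d => !![((q : ℝ) : ℂ)⁻¹ • gen q .d, 0; 0, gen q .d]) <| by
    have h0 := Param.ne_zero q
    constructor <;> ext i j <;> fin_cases i <;> fin_cases j <;>
    simp [Matrix.mul_apply, Fin.sum_univ_two, gen_ab, gen_ac, gen_bd, gen_cd, gen_ad, gen_da,
      gen_bc, smul_smul, h0, -Complex.coe_smul] <;> try match_scalars <;> field_simp


theorem derivHom_entries (f : Coord q) :
    derivHom q f 0 0 = kAut q f ∧ derivHom q f 1 0 = 0 ∧ derivHom q f 1 1 = f := by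
  induction f using Coord.induction with
  | hC z => simp [Matrix.algebraMap_matrix_apply]
  | hg g => cases g <;> simp [derivHom, kAut]
  | hadd f g hf hg => simp [hf, hg]
  | hmul f g hf hg => simp [Matrix.mul_apply, Fin.sum_univ_two, hf, hg]

/-- The twisted derivation `E`. -/
noncomputable def deriv : Coord q →ₗ[ℂ] Coord q where
  toFun f := derivHom q f 0 1
  map_add' f g := by simp
  map_smul' z f := by simp

theorem deriv_mul (f g : Coord q) :
    deriv q (f * g) = kAut q f * deriv q g + deriv q f * g := by
  have hf := derivHom_entries q f
  have hg := derivHom_entries q g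
  simp [deriv, Matrix.mul_apply, Fin.sum_univ_two, hf, hg]

theorem deriv_one : deriv q 1 = 0 := by simp [deriv]

theorem deriv_gen : deriv q (gen q .a) = gen q .b ∧ deriv q (gen q .b) = 0 ∧
    deriv q (gen q .c) = gen q .d ∧ deriv q (gen q .d) = 0 := by
  simp [deriv, derivHom]

theorem comul_kAut (f : Coord q) : comul q (kAut q f) =
    Algebra.TensorProduct.map (AlgHom.id ℂ (Coord q)) (kAut q) (comul q f) := by
  induction f using Coord.induction with
  | hC z => simp only [AlgHom.commutes]
  | hg g => cases g <;> simp [comul, kAut, smul_add, -Complex.coe_smul]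
  | hadd f g hf hg => simp only [map_add, hf, hg]
  | hmul f g hf hg => simp only [map_mul, hf, hg]

theorem lTensor_deriv_mul (x y : Coord q ⊗[ℂ] Coord q) :
    (deriv q).lTensor (Coord q) (x * y) =
      Algebra.TensorProduct.map (AlgHom.id ℂ (Coord q)) (kAut q) x *
        (deriv q).lTensor (Coord q) y + (deriv q).lTensor (Coord q) x * y := by
  induction x with
  | zero => simp
  | add x x' hx hx' => simp only [add_mul, map_add, hx, hx']; abel
  | tmul x x' =>
    induction y with
    | zero => simp
    | add y y' hy hy' => simp only [mul_add, map_add, hy, hy']; abel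
    | tmul y y' => simp [deriv_mul, TensorProduct.tmul_add]

theorem comul_deriv (f : Coord q) :
    comul q (deriv q f) = (deriv q).lTensor (Coord q) (comul q f) := by
  induction f using Coord.induction with
  | hC z => rw [Algebra.algebraMap_eq_smul_one]; simp [deriv_one, Algebra.TensorProduct.one_def]
  | hg g =>
    have h := deriv_gen q
    cases g <;> simp [h] <;> simp [comul, h]
  | hadd f g hf hg => simp only [map_add, hf, hg]
  | hmul f g hf hg =>
    rw [deriv_mul, map_add, map_mul, map_mul, map_mul, lTensor_deriv_mul, hf, hg, comul_kAut]

/-- The monomials `a^i c^j b^k d^m`. -/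
noncomputable def mon (i j k m : ℕ) : Coord q :=
  gen q .a ^ i * gen q .c ^ j * gen q .b ^ k * gen q .d ^ m

theorem pow_qcomm {q : Param} {x y : Coord q} {r : ℂ} (h : y * x = r • (x * y)) (n : ℕ) :
    y ^ n * x = r ^ n • (x * y ^ n) := by
  induction n with
  | zero => simp
  | succ n ih =>
    rw [pow_succ, mul_assoc, h, mul_smul_comm, ← mul_assoc, ih, smul_mul_assoc, smul_smul,
      mul_assoc, ← pow_succ, ← pow_succ', pow_succ]

theorem gen_inv_comm {q : Param} {x y : Coord q} (h : x * y = ((q : ℝ) : ℂ) • (y * x)) :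
    y * x = ((q : ℝ) : ℂ)⁻¹ • (x * y) := by
  rw [h, smul_smul, inv_mul_cancel₀ (Param.ne_zero q), one_smul]

theorem pow_gen_ba (n : ℕ) : gen q .b ^ n * gen q .a =
    (((q : ℝ) : ℂ)⁻¹) ^ n • (gen q .a * gen q .b ^ n) := pow_qcomm (gen_inv_comm (gen_ab q)) n
theorem pow_gen_ca (n : ℕ) : gen q .c ^ n * gen q .a =
    (((q : ℝ) : ℂ)⁻¹) ^ n • (gen q .a * gen q .c ^ n) := pow_qcomm (gen_inv_comm (gen_ac q)) n
theorem pow_gen_db (n : ℕ) : gen q .d ^ n * gen q .b =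
    (((q : ℝ) : ℂ)⁻¹) ^ n • (gen q .b * gen q .d ^ n) := pow_qcomm (gen_inv_comm (gen_bd q)) n
theorem pow_gen_dc (n : ℕ) : gen q .d ^ n * gen q .c =
    (((q : ℝ) : ℂ)⁻¹) ^ n • (gen q .c * gen q .d ^ n) := pow_qcomm (gen_inv_comm (gen_cd q)) n

theorem pow_gen_bd (n : ℕ) : gen q .d * gen q .b ^ n =
    (((q : ℝ) : ℂ)⁻¹) ^ n • (gen q .b ^ n * gen q .d) := by
  induction n with
  | zero => simp
  | succ n ih =>
    rw [pow_succ, ← mul_assoc, ih, smul_mul_assoc, mul_assoc, gen_inv_comm (gen_bd q),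
      mul_smul_comm, smul_smul, ← mul_assoc, pow_succ]

theorem pow_gen_bc (n : ℕ) : gen q .b * gen q .c ^ n = gen q .c ^ n * gen q .b :=
  ((show Commute _ _ from gen_bc q).pow_right n)
theorem pow_gen_bc' (n : ℕ) : gen q .b ^ n * gen q .c = gen q .c * gen q .b ^ n :=
  ((show Commute _ _ from gen_bc q).pow_left n)

theorem span_mon : Submodule.span ℂ {x | ∃ i j k m, x = mon q i j k m} = ⊤ := by
  set S := Submodule.span ℂ {x | ∃ i j k m, x = mon q i j k m} with hS
  have hm : ∀ i j k m, mon q i j k m ∈ S := fun i j k m =>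
    Submodule.subset_span ⟨i, j, k, m, rfl⟩
  have ext : ∀ g : Coord q, (∀ i j k m, mon q i j k m * g ∈ S) → ∀ s ∈ S, s * g ∈ S := by
    intro g h s hs
    induction hs using Submodule.span_induction with
    | mem x hx => obtain ⟨i, j, k, m, rfl⟩ := hx; exact h i j k m
    | zero => simp
    | add x y _ _ hx hy => rw [add_mul]; exact S.add_mem hx hy
    | smul z x _ hx => rw [smul_mul_assoc]; exact S.smul_mem _ hx
  have hd : ∀ s ∈ S, s * gen q .d ∈ S := ext _ fun i j k m => by
    rw [mon, mul_assoc, ← pow_succ]; exact hm _ _ _ _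
  have hb : ∀ s ∈ S, s * gen q .b ∈ S := ext _ fun i j k m => by
    rw [mon, mul_assoc, pow_gen_db, mul_smul_comm, ← mul_assoc, mul_assoc _ (gen q .b ^ k),
      ← pow_succ]
    exact S.smul_mem _ (hm _ _ _ _)
  have hc : ∀ s ∈ S, s * gen q .c ∈ S := ext _ fun i j k m => by
    rw [mon, mul_assoc, pow_gen_dc, mul_smul_comm, ← mul_assoc, mul_assoc _ (gen q .b ^ k),
      pow_gen_bc', ← mul_assoc, mul_assoc _ (gen q .c ^ j), ← pow_succ]
    exact S.smul_mem _ (hm _ _ _ _)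
  have ha : ∀ s ∈ S, s * gen q .a ∈ S := ext _ fun i j k m => by
    rcases m with _ | m
    · rw [mon, pow_zero, mul_one, mul_assoc, pow_gen_ba, mul_smul_comm, ← mul_assoc,
        mul_assoc _ (gen q .c ^ j), pow_gen_ca, mul_smul_comm, ← mul_assoc, ← pow_succ,
        smul_mul_assoc]
      have := hm (i + 1) j k 0
      rw [mon, pow_zero, mul_one] at this
      exact S.smul_mem _ (S.smul_mem _ this)
    · have : mon q i j k (m + 1) * gen q .a = mon q i j k m +
          ((q : ℝ) : ℂ)⁻¹ • (mon q i j k m * gen q .b * gen q .c) := by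
        rw [mon, pow_succ, ← mul_assoc, mul_assoc _ (gen q .d), gen_da, mul_add, mul_one,
          mul_smul_comm, mul_assoc _ (gen q .b) (gen q .c)]
        rfl
      rw [this]
      exact S.add_mem (hm _ _ _ _) (S.smul_mem _ (hc _ (hb _ (hm _ _ _ _))))
  rw [eq_top_iff]
  rintro f -
  have key : ∀ s ∈ S, s * f ∈ S := by
    induction f using Coord.induction with
    | hC z =>
      intro s hs
      rw [← Algebra.commutes, ← Algebra.smul_def]; exact S.smul_mem _ hs
    | hg g => cases g; exacts [ha, hb, hc, hd]
    | hadd f g hf hg => intro s hs; rw [mul_add]; exact S.add_mem (hf s hs) (hg s hs)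
    | hmul f g hf hg => intro s hs; rw [← mul_assoc]; exact hg _ (hf _ hs)
  have := key 1 (by simpa [mon] using hm 0 0 0 0)
  rwa [one_mul] at this

/-- The numbers `(q^i - q^(-i)) / (q - q⁻¹)`. -/
noncomputable def num : ℕ → ℝ
  | 0 => 0
  | n + 1 => (q : ℝ) * num n + ((q : ℝ)⁻¹) ^ n

theorem num_nonneg (n : ℕ) : 0 ≤ num q n := by
  have := q.2.1
  induction n with
  | zero => simp [num]
  | succ n ih => rw [num]; positivity

theorem num_succ_pos (n : ℕ) : 0 < num q (n + 1) := by
  have := q.2.1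
  have := num_nonneg q n
  rw [num]; positivity

theorem num_eq (n : ℕ) : ((q : ℝ) ^ 2 - 1) * (q : ℝ) ^ n * num q (n + 1) =
    (q : ℝ) ^ (2 * n + 2) - 1 := by
  have h0 : (q : ℝ) ≠ 0 := q.2.1.ne'
  induction n with
  | zero => simp [num]
  | succ n ih =>
    rw [num, inv_pow]
    have : ((q : ℝ) ^ 2 - 1) * (q : ℝ) ^ (n + 1) * ((q : ℝ) * num q (n + 1) + ((q : ℝ) ^ (n + 1))⁻¹)
      = (q : ℝ) ^ 2 * (((q : ℝ) ^ 2 - 1) * (q : ℝ) ^ n * num q (n + 1)) + ((q : ℝ) ^ 2 - 1) := by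
      field_simp; ring
    rw [this, ih]; ring

theorem kAut_gen : kAut q (gen q .a) = ((q : ℝ) : ℂ) • gen q .a ∧
    kAut q (gen q .b) = ((q : ℝ) : ℂ)⁻¹ • gen q .b ∧
    kAut q (gen q .c) = ((q : ℝ) : ℂ) • gen q .c ∧
    kAut q (gen q .d) = ((q : ℝ) : ℂ)⁻¹ • gen q .d := by
  simp [kAut, -Complex.coe_smul]

theorem deriv_pow_zero {q : Param} {x : Coord q} (h : deriv q x = 0) (n : ℕ) :
    deriv q (x ^ n) = 0 := by
  induction n with
  | zero => simp [deriv_one]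
  | succ n ih => rw [pow_succ, deriv_mul, h, ih]; simp

theorem deriv_pow {q : Param} {x y : Coord q} (hk : kAut q x = ((q : ℝ) : ℂ) • x)
    (h : deriv q x = y) (hxy : x * y = ((q : ℝ) : ℂ) • (y * x)) (n : ℕ) :
    deriv q (x ^ (n + 1)) = (num q (n + 1) : ℂ) • (x ^ n * y) := by
  have hyx := gen_inv_comm hxy
  have hyn : ∀ n : ℕ, y * x ^ n = (((q : ℝ) : ℂ)⁻¹) ^ n • (x ^ n * y) := by
    intro n
    induction n with
    | zero => simp
    | succ n ih =>
      rw [pow_succ, ← mul_assoc, ih, smul_mul_assoc, mul_assoc, hyx, mul_smul_comm, smul_smul,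
        ← mul_assoc, pow_succ]
  induction n with
  | zero => simp [h, num]
  | succ n ih =>
    rw [pow_succ' x (n + 1), deriv_mul, h, hk, ih, hyn,
      show num q (n + 1 + 1) = (q : ℝ) * num q (n + 1) + ((q : ℝ)⁻¹) ^ (n + 1) from rfl]
    rw [smul_mul_smul_comm, ← mul_assoc, ← pow_succ']
    push_cast
    module

theorem deriv_mon (i j k m : ℕ) : deriv q (mon q i j k m) =
    (num q i : ℂ) • mon q (i - 1) j (k + 1) m +
      (((q : ℝ) : ℂ) ^ i * (((q : ℝ) : ℂ)⁻¹) ^ k * num q j) • mon q i (j - 1) k (m + 1) := by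
  obtain ⟨ea, eb, ec, ed⟩ := deriv_gen q
  obtain ⟨ka, -, kc, -⟩ := kAut_gen q
  have h1 : deriv q (mon q i j k m) = (kAut q (gen q .a ^ i) * deriv q (gen q .c ^ j) +
      deriv q (gen q .a ^ i) * gen q .c ^ j) * gen q .b ^ k * gen q .d ^ m := by
    rw [mon, deriv_mul, deriv_pow_zero ed, deriv_mul, deriv_pow_zero eb, deriv_mul]
    simp
  have h2 : kAut q (gen q .a ^ i) = ((q : ℝ) : ℂ) ^ i • gen q .a ^ i := by
    rw [map_pow, ka, smul_pow]
  have h3 : deriv q (gen q .a ^ i) * gen q .c ^ j * gen q .b ^ k * gen q .d ^ m =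
      (num q i : ℂ) • mon q (i - 1) j (k + 1) m := by
    rcases i with _ | i
    · simp [deriv_one, num]
    · rw [deriv_pow ka ea (gen_ab q), smul_mul_assoc, smul_mul_assoc, smul_mul_assoc,
        mul_assoc _ (gen q .b), pow_gen_bc, ← mul_assoc, mul_assoc _ (gen q .b), ← pow_succ',
        Nat.add_sub_cancel, mon]
  have h4 : gen q .a ^ i * deriv q (gen q .c ^ j) * gen q .b ^ k * gen q .d ^ m =
      ((((q : ℝ) : ℂ)⁻¹) ^ k * num q j) • mon q i (j - 1) k (m + 1) := by
    rcases j with _ | j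
    · simp [deriv_one, num]
    · rw [deriv_pow kc ec (gen_cd q), mul_smul_comm, smul_mul_assoc, smul_mul_assoc,
        ← mul_assoc, mul_assoc _ (gen q .d), pow_gen_bd, mul_smul_comm, smul_mul_assoc, smul_smul,
        ← mul_assoc, mul_assoc _ (gen q .d), ← pow_succ', Nat.add_sub_cancel, mon, mul_comm]
  rw [h1, add_mul, add_mul, h3, h2, smul_mul_assoc, smul_mul_assoc, smul_mul_assoc, h4, smul_smul,
    add_comm, mul_assoc]


theorem rep_pow_d (m n : ℕ) (l : ℤ) (z : ℂ) :
    rep q (gen q .d ^ m) (Finsupp.single (n, l) z) =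
      Finsupp.single (n + m, l) (z * ∏ r ∈ Finset.range m, rt q (n + r + 1)) := by
  induction m with
  | zero => simp
  | succ m ih =>
    rw [pow_succ', map_mul, Module.End.mul_apply, ih, rep, lift_gen, repGen, wshift_single,
      Finset.prod_range_succ, mul_assoc]
    rfl

theorem rep_pow_a (m n : ℕ) (l : ℤ) (z : ℂ) :
    rep q (gen q .a ^ m) (Finsupp.single (n + m, l) z) =
      Finsupp.single (n, l) (z * ∏ r ∈ Finset.range m, rt q (n + r + 1)) := by
  induction m generalizing z with
  | zero => simp
  | succ m ih =>
    rw [pow_succ, map_mul, Module.End.mul_apply, rep, lift_gen, repGen, wshift_single, ← rep,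
      show (n + (m + 1) - 1) = n + m by omega, ih, Finset.prod_range_succ,
      show n + (m + 1) = n + m + 1 by omega]
    congr 1; ring

theorem rep_pow_b (k n : ℕ) (l : ℤ) (z : ℂ) :
    rep q (gen q .b ^ k) (Finsupp.single (n, l) z) =
      Finsupp.single (n, l - k) (z * (-((q : ℝ) : ℂ) ^ (n + 1)) ^ k) := by
  induction k with
  | zero => simp
  | succ k ih =>
    rw [pow_succ', map_mul, Module.End.mul_apply, ih, rep, lift_gen, repGen, wshift_single,
      pow_succ, mul_assoc]
    congr 2; push_cast; ring

theorem rep_pow_c (k n : ℕ) (l : ℤ) (z : ℂ) :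
    rep q (gen q .c ^ k) (Finsupp.single (n, l) z) =
      Finsupp.single (n, l + k) (z * (((q : ℝ) : ℂ) ^ n) ^ k) := by
  induction k with
  | zero => simp
  | succ k ih =>
    rw [pow_succ', map_mul, Module.End.mul_apply, ih, rep, lift_gen, repGen, wshift_single,
      pow_succ, mul_assoc]
    congr 2; push_cast; ring

/-- The product `∏_{r < m} (1 - q^(2(n+r+1)))`. -/
noncomputable def qprod (m n : ℕ) : ℂ :=
  ∏ r ∈ Finset.range m, (1 - ((q : ℝ) : ℂ) ^ (2 * (n + r + 1)))

theorem entry_mon (j m n : ℕ) : entry q (mon q m j j m) (n, 0) (n, 0) =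
    qprod q m n * (-1) ^ j * ((q : ℝ) : ℂ) ^ ((2 * n + 2 * m + 1) * j) := by
  have h : (∏ r ∈ Finset.range m, rt q (n + r + 1)) * (∏ r ∈ Finset.range m, rt q (n + r + 1)) =
      qprod q m n := by
    rw [← Finset.prod_mul_distrib]; exact Finset.prod_congr rfl fun r _ => rt_mul_self q _
  rw [entry, mon, map_mul, map_mul, map_mul, Module.End.mul_apply, Module.End.mul_apply,
    Module.End.mul_apply, rep_pow_d, rep_pow_b, rep_pow_c, rep_pow_a, sub_add_cancel,
    Finsupp.single_eq_same, ← h, neg_pow]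
  ring

theorem kAut_mon (i j k m : ℕ) : kAut q (mon q i j k m) =
    ((q : ℝ) : ℂ) ^ ((i : ℤ) + j - k - m) • mon q i j k m := by
  obtain ⟨ka, kb, kc, kd⟩ := kAut_gen q
  have h0 := Param.ne_zero q
  rw [mon, map_mul, map_mul, map_mul, map_pow, map_pow, map_pow, map_pow, ka, kb, kc, kd,
    smul_pow, smul_pow, smul_pow, smul_pow, smul_mul_smul_comm, smul_mul_smul_comm,
    smul_mul_smul_comm, zpow_sub₀ h0, zpow_sub₀ h0, zpow_add₀ h0]
  congr 1
  simp only [zpow_natCast, inv_pow, div_eq_mul_inv]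

theorem zpow_ne_one {w : ℤ} (hw : w ≠ 0) : ((q : ℝ) : ℂ) ^ w ≠ 1 := by
  intro h
  have h1 : ((q : ℝ)) ^ w = 1 := by exact_mod_cast h
  rw [zpow_eq_one_iff_right₀ q.2.1.le q.2.2.ne] at h1
  exact hw h1

theorem haar_mon_weight {i j k m : ℕ} (h : i + j ≠ k + m) : haar q (mon q i j k m) = 0 := by
  have h1 := haar_kAut q (mon q i j k m)
  rw [kAut_mon, map_smul, smul_eq_mul] at h1
  have h2 := zpow_ne_one q (w := (i : ℤ) + j - k - m) (by omega)
  have h3 := sub_ne_zero.2 h2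
  refine (mul_eq_zero.1 (?_ : (((q : ℝ) : ℂ) ^ ((i : ℤ) + j - k - m) - 1) * _ = 0)).resolve_left h3
  rw [sub_mul, h1, one_mul, sub_self]

theorem flipAut_mon (i j k m : ℕ) : flipAut q (mon q i j k m) = mon q i k j m := by
  simp only [mon, map_mul, map_pow, flipAut, lift_gen]
  rw [mul_assoc (gen q .a ^ i), mul_assoc (gen q .a ^ i),
    (show Commute _ _ from gen_bc q).pow_pow j k, ← mul_assoc, ← mul_assoc]

theorem haar_mon_eq_zero {i j k m : ℕ} (h : ¬ (i = m ∧ j = k)) : haar q (mon q i j k m) = 0 := by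
  by_cases h1 : i + j = k + m
  · rw [← haar_flipAut, flipAut_mon]
    exact haar_mon_weight q (by omega)
  · exact haar_mon_weight q h1

theorem norm_q : ‖((q : ℝ) : ℂ)‖ = q := by
  rw [Complex.norm_real, Real.norm_of_nonneg q.2.1.le]

theorem norm_qprod_le (m n : ℕ) : ‖qprod q m n‖ ≤ 1 := by
  rw [qprod, norm_prod]
  refine Finset.prod_le_one (fun _ _ => norm_nonneg _) fun r _ => ?_
  rw [← rt_mul_self, norm_mul]
  exact mul_le_one₀ (norm_rt_le q _) (norm_nonneg _) (norm_rt_le q _)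

theorem qprod_shift (m n : ℕ) : (1 - ((q : ℝ) : ℂ) ^ (2 * (n + 1))) * qprod q m (n + 1) =
    qprod q m n * (1 - ((q : ℝ) : ℂ) ^ (2 * (n + m + 1))) := by
  have h1 : qprod q (m + 1) n = qprod q m n * (1 - ((q : ℝ) : ℂ) ^ (2 * (n + m + 1))) := by
    rw [qprod, Finset.prod_range_succ]; rfl
  rw [← h1, qprod, qprod, Finset.prod_range_succ', mul_comm]
  congr 1
  exact Finset.prod_congr rfl fun r _ => by congr 2; ring

theorem haar_deriv_aux (k m : ℕ) :
    (num q (m + 1) : ℂ) * haar q (mon q m (k + 1) (k + 1) m) +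
      (((q : ℝ) : ℂ) ^ (m + 1) * (((q : ℝ) : ℂ)⁻¹) ^ k * num q (k + 1)) *
        haar q (mon q (m + 1) k k (m + 1)) = 0 := by
  have h0 := Param.ne_zero q
  set Q : ℂ := ((q : ℝ) : ℂ) with hQ
  have hN : ∀ n, (Q ^ 2 - 1) * Q ^ n * (num q (n + 1) : ℂ) = Q ^ (2 * n + 2) - 1 := fun n => by
    rw [hQ]; exact_mod_cast num_eq q n
  set G : ℕ → ℂ := fun n => Q ^ (2 * n * (k + 1)) * ((1 - Q ^ (2 * n)) * qprod q m n) with hG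
  have hGs : Summable G := by
    refine Summable.of_norm_bounded (g := fun n => ((q : ℝ) ^ 2) ^ n)
      (summable_geometric_of_lt_one (sq_nonneg _) (pow_lt_one₀ q.2.1.le q.2.2 two_ne_zero))
      fun n => ?_
    have h1 : ‖1 - Q ^ (2 * n)‖ ≤ 1 := by
      rw [hQ, ← rt_mul_self, norm_mul]
      exact mul_le_one₀ (norm_rt_le q _) (norm_nonneg _) (norm_rt_le q _)
    have h2 : ‖Q ^ (2 * n * (k + 1))‖ ≤ ((q : ℝ) ^ 2) ^ n := by
      rw [norm_pow, hQ, norm_q, ← pow_mul]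
      exact pow_le_pow_of_le_one q.2.1.le q.2.2.le (Nat.le_mul_of_pos_right _ (Nat.succ_pos k))
    calc ‖G n‖ = ‖Q ^ (2 * n * (k + 1))‖ * (‖1 - Q ^ (2 * n)‖ * ‖qprod q m n‖) := by
          rw [hG]; simp only [norm_mul]
      _ ≤ ((q : ℝ) ^ 2) ^ n * 1 := mul_le_mul h2
          (mul_le_one₀ h1 (norm_nonneg _) (norm_qprod_le q m n)) (by positivity) (by positivity)
      _ = _ := mul_one _
  have hG0 : G 0 = 0 := by simp [hG]
  have htel : ∑' n, (G n - G (n + 1)) = 0 := by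
    rw [hGs.tsum_sub ((summable_nat_add_iff 1).2 hGs), hGs.tsum_eq_zero_add, hG0]; ring
  have hA := haar_summable (mon q m (k + 1) (k + 1) m)
  have hB := haar_summable (mon q (m + 1) k k (m + 1))
  have hK : (Q ^ 2 - 1) * Q ^ m * Q ^ k ≠ 0 := by
    refine mul_ne_zero (mul_ne_zero (sub_ne_zero.2 ?_) (pow_ne_zero _ h0)) (pow_ne_zero _ h0)
    have := zpow_ne_one q (w := 2) two_ne_zero
    rwa [zpow_ofNat] at this
  refine (mul_eq_zero.1 (?_ : ((Q ^ 2 - 1) * Q ^ m * Q ^ k) * _ = 0)).resolve_left hK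
  rw [haar_apply, haar_apply, ← hQ]
  have hcomb : ∑' n, ((Q ^ 2 - 1) * Q ^ m * Q ^ k * (num q (m + 1) : ℂ) *
        (Q ^ (2 * n) * entry q (mon q m (k + 1) (k + 1) m) (n, 0) (n, 0)) +
      (Q ^ 2 - 1) * Q ^ m * Q ^ k * (Q ^ (m + 1) * Q⁻¹ ^ k * num q (k + 1)) *
        (Q ^ (2 * n) * entry q (mon q (m + 1) k k (m + 1)) (n, 0) (n, 0))) = 0 := by
    have : ∀ n, ((Q ^ 2 - 1) * Q ^ m * Q ^ k * (num q (m + 1) : ℂ) *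
        (Q ^ (2 * n) * entry q (mon q m (k + 1) (k + 1) m) (n, 0) (n, 0)) +
      (Q ^ 2 - 1) * Q ^ m * Q ^ k * (Q ^ (m + 1) * Q⁻¹ ^ k * num q (k + 1)) *
        (Q ^ (2 * n) * entry q (mon q (m + 1) k k (m + 1)) (n, 0) (n, 0))) =
      ((-1) ^ (k + 1) * Q ^ (2 * m * k + 2 * m + 2 * k + 1)) * (G n - G (n + 1)) := by
      intro n
      have hs := qprod_shift q m n
      have e1 : (Q ^ 2 - 1) * Q ^ m * Q ^ k * (num q (m + 1) : ℂ) =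
          (Q ^ (2 * m + 2) - 1) * Q ^ k := by rw [← hN m]; ring
      have e2 : (Q ^ 2 - 1) * Q ^ m * Q ^ k * (Q ^ (m + 1) * Q⁻¹ ^ k * num q (k + 1)) =
          (Q ^ (2 * k + 2) - 1) * Q ^ (2 * m + 1) * Q⁻¹ ^ k := by rw [← hN k]; ring
      have e3 : Q⁻¹ ^ k * Q ^ ((2 * n + 2 * (m + 1) + 1) * k) = Q ^ ((2 * n + 2 * m + 2) * k) := by
        rw [inv_pow, show (2 * n + 2 * (m + 1) + 1) * k = (2 * n + 2 * m + 2) * k + k by ring,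
          pow_add, mul_comm (Q ^ _) (Q ^ k), inv_mul_cancel_left₀ (pow_ne_zero _ h0)]
      have e4 : qprod q (m + 1) n = qprod q m n * (1 - Q ^ (2 * (n + m + 1))) := by
        rw [qprod, Finset.prod_range_succ]; rfl
      rw [e1, e2, entry_mon, entry_mon, e4, ← hQ, hG]
      simp only
      rw [hs, ← hQ]
      linear_combination ((Q ^ (2 * k + 2) - 1) * Q ^ (2 * m + 1) * Q ^ (2 * n) * qprod q m n *
        (1 - Q ^ (2 * (n + m + 1))) * (-1) ^ k) * e3
    simp only [this]
    rw [tsum_mul_left, htel, mul_zero]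
  rw [(hA.mul_left _).tsum_add (hB.mul_left _), tsum_mul_left, tsum_mul_left] at hcomb
  linear_combination (1 - Q ^ 2) * hcomb

theorem haar_deriv (f : Coord q) : haar q (deriv q f) = 0 := by
  have hf : f ∈ Submodule.span ℂ {x | ∃ i j k m, x = mon q i j k m} := by
    rw [span_mon]; trivial
  induction hf using Submodule.span_induction with
  | mem x hx =>
    obtain ⟨i, j, k, m, rfl⟩ := hx
    rw [deriv_mon, map_add, map_smul, map_smul, smul_eq_mul, smul_eq_mul]
    rcases i with _ | i
    · have h : haar q (mon q 0 (j - 1) k (m + 1)) = 0 := haar_mon_eq_zero q (by omega)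
      rw [h]; simp [num]
    · rcases j with _ | j
      · rw [haar_mon_eq_zero q (j := 0) (by omega)]; simp [num]
      · simp only [Nat.add_sub_cancel]
        by_cases h : i = m ∧ j = k
        · obtain ⟨rfl, rfl⟩ := h
          exact haar_deriv_aux q j i
        · rw [haar_mon_eq_zero q (by omega), haar_mon_eq_zero q (by omega), mul_zero, mul_zero,
            add_zero]
  | zero => simp
  | add x y _ _ hx hy => rw [map_add, map_add, hx, hy, add_zero]
  | smul z x _ hx => rw [map_smul, map_smul, hx, smul_zero]

/-- The map `f ↦ (id ⊗ h)(Δ f)`. -/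
noncomputable def avg : Coord q →ₗ[ℂ] Coord q :=
  (TensorProduct.rid ℂ (Coord q)).toLinearMap ∘ₗ (haar q).lTensor (Coord q) ∘ₗ
    (comul q).toLinearMap

theorem avg_apply (f : Coord q) : avg q f =
    TensorProduct.rid ℂ (Coord q) ((haar q).lTensor (Coord q) (comul q f)) := rfl

theorem avg_deriv (f : Coord q) : avg q (deriv q f) = 0 := by
  have : haar q ∘ₗ deriv q = 0 := LinearMap.ext (haar_deriv q)
  rw [avg_apply, comul_deriv, ← LinearMap.lTensor_comp_apply, this]
  simp

theorem avg_kAut (f : Coord q) : avg q (kAut q f) = avg q f := by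
  have h1 : haar q ∘ₗ (kAut q).toLinearMap = haar q := LinearMap.ext (haar_kAut q)
  have h2 : ∀ x : Coord q ⊗[ℂ] Coord q,
      Algebra.TensorProduct.map (AlgHom.id ℂ (Coord q)) (kAut q) x =
        (kAut q).toLinearMap.lTensor (Coord q) x := fun _ => rfl
  rw [avg_apply, comul_kAut, h2, ← LinearMap.lTensor_comp_apply, h1, ← avg_apply]

/-- The elements on which right averaging agrees with the Haar functional. -/
noncomputable def good : Submodule ℂ (Coord q) :=
  LinearMap.eqLocus (avg q) ((haar q).smulRight 1)

theorem mem_good {f : Coord q} : f ∈ good q ↔ avg q f = haar q f • 1 := Iff.rfl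

theorem deriv_mem_good (f : Coord q) : deriv q f ∈ good q := by
  rw [mem_good, avg_deriv, haar_deriv, zero_smul]

theorem one_mem_good : 1 ∈ good q := by
  rw [mem_good, avg_apply, map_one, Algebra.TensorProduct.one_def, LinearMap.lTensor_tmul,
    TensorProduct.rid_tmul]

theorem mon_mem_good_of_weight {i j k m : ℕ} (h : i + j ≠ k + m) : mon q i j k m ∈ good q := by
  have h1 := avg_kAut q (mon q i j k m)
  rw [kAut_mon, map_smul] at h1
  have h3 := sub_ne_zero.2 (zpow_ne_one q (w := (i : ℤ) + j - k - m) (by omega))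
  rw [mem_good, haar_mon_weight q h, zero_smul]
  refine (smul_eq_zero.1 (?_ : (((q : ℝ) : ℂ) ^ ((i : ℤ) + j - k - m) - 1) •
    avg q (mon q i j k m) = 0)).resolve_left h3
  rw [sub_smul, h1, one_smul, sub_self]

theorem num_ne_zero (n : ℕ) : (num q (n + 1) : ℂ) ≠ 0 := by
  exact_mod_cast (num_succ_pos q n).ne'

theorem mon_mem_good_iff (i j k m : ℕ) :
    mon q i (j + 1) (k + 1) m ∈ good q ↔ mon q (i + 1) j k (m + 1) ∈ good q := by
  have h0 := Param.ne_zero q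
  have h := deriv_mem_good q (mon q (i + 1) (j + 1) k m)
  rw [deriv_mon, Nat.add_sub_cancel, Nat.add_sub_cancel] at h
  have hc : ((q : ℝ) : ℂ) ^ (i + 1) * (((q : ℝ) : ℂ)⁻¹) ^ k * num q (j + 1) ≠ 0 :=
    mul_ne_zero (mul_ne_zero (pow_ne_zero _ h0) (pow_ne_zero _ (inv_ne_zero h0))) (num_ne_zero q j)
  constructor
  · intro h'
    exact ((good q).smul_mem_iff hc).1 (((good q).add_mem_iff_right
      ((good q).smul_mem _ h')).1 h)
  · intro h'
    exact ((good q).smul_mem_iff (num_ne_zero q i)).1 (((good q).add_mem_iff_left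
      ((good q).smul_mem _ h')).1 h)

theorem mon_mem_good_left (j k m : ℕ) : mon q 0 j k (m + 1) ∈ good q := by
  have h0 := Param.ne_zero q
  have h := deriv_mem_good q (mon q 0 (j + 1) k m)
  rw [deriv_mon] at h
  simp only [num, Complex.ofReal_zero, zero_smul, zero_add, Nat.add_sub_cancel, pow_zero,
    one_mul] at h
  exact ((good q).smul_mem_iff (mul_ne_zero (pow_ne_zero _ (inv_ne_zero h0))
    (num_ne_zero q j))).1 h

theorem mon_mem_good_right (i k m : ℕ) : mon q i 0 (k + 1) m ∈ good q := by
  have h := deriv_mem_good q (mon q (i + 1) 0 k m)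
  rw [deriv_mon] at h
  simp only [num.eq_1, Complex.ofReal_zero, zero_smul, add_zero, mul_zero,
    Nat.add_sub_cancel] at h
  exact ((good q).smul_mem_iff (num_ne_zero q i)).1 h

theorem mon_mem_good_lt (i : ℕ) : ∀ j k m, i < m → mon q i j k m ∈ good q := by
  induction i with
  | zero =>
    intro j k m h
    obtain ⟨m, rfl⟩ := Nat.exists_eq_succ_of_ne_zero h.ne'
    exact mon_mem_good_left q j k m
  | succ i ih =>
    intro j k m h
    obtain ⟨m, rfl⟩ := Nat.exists_eq_succ_of_ne_zero (Nat.ne_zero_of_lt h)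
    exact (mon_mem_good_iff q i j k m).1 (ih _ _ _ (by omega))

theorem mon_mem_good_gt (j : ℕ) : ∀ i k m, j < k → mon q i j k m ∈ good q := by
  induction j with
  | zero =>
    intro i k m h
    obtain ⟨k, rfl⟩ := Nat.exists_eq_succ_of_ne_zero h.ne'
    exact mon_mem_good_right q i k m
  | succ j ih =>
    intro i k m h
    obtain ⟨k, rfl⟩ := Nat.exists_eq_succ_of_ne_zero (Nat.ne_zero_of_lt h)
    exact (mon_mem_good_iff q i j k m).2 (ih _ _ _ (by omega))

theorem mon_split (n : ℕ) : mon q 0 n n 0 =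
    (((q : ℝ) : ℂ)⁻¹ ^ n * ((q : ℝ) : ℂ)⁻¹ ^ n) • mon q 1 n n 1 -
      ((q : ℝ) : ℂ) • mon q 0 (n + 1) (n + 1) 0 := by
  have h1 : (1 : Coord q) = gen q .a * gen q .d - ((q : ℝ) : ℂ) • (gen q .c * gen q .b) := by
    rw [gen_ad, gen_bc, add_sub_cancel_right]
  have h2 : mon q 0 n n 0 = gen q .c ^ n * 1 * gen q .b ^ n := by simp [mon]
  rw [h2, h1, mul_sub, sub_mul]
  congr 1
  · rw [← mul_assoc, pow_gen_ca, mul_assoc, pow_gen_bd, smul_mul_smul_comm, mon, pow_one, pow_one]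
    simp only [mul_assoc]
  · rw [mul_smul_comm, smul_mul_assoc, mon, pow_zero, pow_zero, mul_one, one_mul, pow_succ,
      pow_succ']
    simp only [mul_assoc]

theorem mon_mem_good_diag (n : ℕ) : mon q 0 n n 0 ∈ good q := by
  have h0 := Param.ne_zero q
  induction n with
  | zero => simpa [mon] using one_mem_good q
  | succ n ih =>
    have h := deriv_mem_good q (mon q 1 (n + 1) n 0)
    have hs := mon_split q n
    rw [deriv_mon] at h
    simp only [Nat.sub_self, Nat.add_sub_cancel, zero_add] at h
    have hn : num q 1 = 1 := by simp [num]
    set c : ℝ := (q : ℝ) * ((q : ℝ)⁻¹) ^ n * num q (n + 1) with hc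
    have hq := q.2.1
    have hcpos : 0 < c := by have := num_succ_pos q n; positivity
    have hcC : ((q : ℝ) : ℂ) ^ 1 * ((q : ℝ) : ℂ)⁻¹ ^ n * (num q (n + 1) : ℂ) = (c : ℂ) := by
      rw [hc]; push_cast; ring
    rw [hcC, hn, Complex.ofReal_one, one_smul] at h
    set r : ℝ := (q : ℝ)⁻¹ ^ n * (q : ℝ)⁻¹ ^ n with hr
    have hrC : ((q : ℝ) : ℂ)⁻¹ ^ n * ((q : ℝ) : ℂ)⁻¹ ^ n = (r : ℂ) := by rw [hr]; push_cast; ring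
    rw [hrC] at hs
    have hcomb : ((r + c * q : ℝ) : ℂ) • mon q 0 (n + 1) (n + 1) 0 =
        (r : ℂ) • (mon q 0 (n + 1) (n + 1) 0 + (c : ℂ) • mon q 1 n n 1) -
          (c : ℂ) • mon q 0 n n 0 := by
      rw [hs]; push_cast; module
    have hpos : ((r + c * q : ℝ) : ℂ) ≠ 0 := by
      have : 0 < r + c * q := by positivity
      exact_mod_cast this.ne'
    refine ((good q).smul_mem_iff hpos).1 ?_
    rw [hcomb]
    exact (good q).sub_mem ((good q).smul_mem _ h) ((good q).smul_mem _ ih)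

theorem mon_mem_good_mid (i : ℕ) : ∀ j, mon q i j j i ∈ good q := by
  induction i with
  | zero => exact mon_mem_good_diag q
  | succ i ih => exact fun j => (mon_mem_good_iff q i j j i).1 (ih _)

theorem good_eq_top : good q = ⊤ := by
  rw [eq_top_iff, ← span_mon, Submodule.span_le]
  rintro _ ⟨i, j, k, m, rfl⟩
  show mon q i j k m ∈ good q
  by_cases h : i + j = k + m
  · rcases lt_trichotomy i m with h1 | h1 | h1
    · exact mon_mem_good_lt q i j k m h1
    · obtain rfl : j = k := by omega
      subst h1
      exact mon_mem_good_mid q i j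
    · exact mon_mem_good_gt q j i k m (by omega)
  · exact mon_mem_good_of_weight q h

theorem comul_flipAut (f : Coord q) : comul q (flipAut q f) =
    TensorProduct.comm ℂ (Coord q) (Coord q)
      (TensorProduct.map (flipAut q).toLinearMap (flipAut q).toLinearMap (comul q f)) := by
  have : (comul q).comp (flipAut q) = ((Algebra.TensorProduct.comm ℂ (Coord q) (Coord q)).toAlgHom.comp
      (Algebra.TensorProduct.map (flipAut q) (flipAut q))).comp (comul q) := by
    refine AlgHom.ext fun f => ?_
    induction f using Coord.induction with
    | hC z => simp only [AlgHom.commutes]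
    | hg g => cases g <;> simp [comul, flipAut]
    | hadd f g hf hg => rw [map_add, map_add, hf, hg]
    | hmul f g hf hg => rw [map_mul, map_mul, hf, hg]
  exact DFunLike.congr_fun this f

/-- The functional `haar` is the Haar functional of `SU_q(2)`. -/
theorem haar_isHaarFunctional : IsHaarFunctional (haar q) := by
  have hgood : ∀ f : Coord q, avg q f = haar q f • 1 := fun f => by
    rw [← mem_good, good_eq_top]; trivial
  intro f
  refine ⟨hgood f, ?_⟩
  have hff : ∀ f, flipAut q (flipAut q f) = f := by
    intro f
    induction f using Coord.induction with
    | hC z => simp only [AlgHom.commutes]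
    | hg g => cases g <;> simp [flipAut]
    | hadd f g hf hg => simp only [map_add, hf, hg]
    | hmul f g hf hg => simp only [map_mul, hf, hg]
  have key : ∀ x : Coord q ⊗[ℂ] Coord q,
      flipAut q (TensorProduct.rid ℂ (Coord q) ((haar q).lTensor (Coord q)
        (TensorProduct.comm ℂ (Coord q) (Coord q)
          (TensorProduct.map (flipAut q).toLinearMap (flipAut q).toLinearMap x)))) =
      TensorProduct.lid ℂ (Coord q) ((haar q).rTensor (Coord q) x) := by
    intro x
    induction x with
    | zero => simp
    | add x y hx hy => simp only [map_add, hx, hy]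
    | tmul x y => simp [haar_flipAut, hff]
  rw [← key, ← comul_flipAut, ← avg_apply, hgood, haar_flipAut, map_smul, map_one]

end Invariance

/-! ### The Hilbert space -/

/-- The coordinate algebra with the inner product `⟨y, x⟩ = h(x y*)`. -/
def PreL2 (q : Param) : Type := Coord q

noncomputable instance (q : Param) : AddCommGroup (PreL2 q) :=
  inferInstanceAs (AddCommGroup (Coord q))

noncomputable instance (q : Param) : Module ℂ (PreL2 q) := inferInstanceAs (Module ℂ (Coord q))

/-- The identity map to `PreL2`. -/
noncomputable def toPreL2 (q : Param) : Coord q ≃ₗ[ℂ] PreL2 q := LinearEquiv.refl ℂ (Coord q)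

/-- The inner product `⟨y, x⟩ = h(x y*)`. -/
noncomputable abbrev innerCore (q : Param) : PreInnerProductSpace.Core ℂ (PreL2 q) where
  inner y x := haar q ((toPreL2 q).symm x * star ((toPreL2 q).symm y))
  conj_inner_symm x y := by rw [← haar_star, star_mul, star_star]
  re_inner_nonneg x := haar_mul_star_nonneg q _
  add_left x y z := by rw [map_add, star_add, mul_add, map_add]
  smul_left x y z := by
    rw [map_smul, star_smul, mul_smul_comm, map_smul, smul_eq_mul]; rfl

noncomputable instance (q : Param) : SeminormedAddCommGroup (PreL2 q) :=
  @InnerProductSpace.Core.toSeminormedAddCommGroup ℂ (PreL2 q) _ _ _ (innerCore q)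

noncomputable instance (q : Param) : InnerProductSpace ℂ (PreL2 q) :=
  InnerProductSpace.ofCore (innerCore q)

/-- The completion of the coordinate algebra for the norm `‖f‖ = h(f f*)^(1/2)`. -/
abbrev L2 (q : Param) : Type := UniformSpace.Completion (PreL2 q)

/-- The canonical map of the coordinate algebra to its completion. -/
noncomputable def toL2 (q : Param) : Coord q →ₗ[ℂ] L2 q :=
  (UniformSpace.Completion.toComplL (𝕜 := ℂ) (E := PreL2 q)).toLinearMap ∘ₗ
    (toPreL2 q).toLinearMap

theorem inner_toL2 (q : Param) (x y : Coord q) :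
    inner ℂ (toL2 q y) (toL2 q x) = haar q (x * star y) :=
  UniformSpace.Completion.inner_coe (𝕜 := ℂ) (E := PreL2 q) _ _

theorem norm_toL2 (q : Param) (x : Coord q) : ‖toL2 q x‖ = √(haar q (x * star x)).re := by
  rw [norm_eq_sqrt_re_inner (𝕜 := ℂ), inner_toL2]; rfl

/-! ### The irreducible corepresentations -/

/-- The generators of the quantum plane. -/
inductive PlaneGen
  | x | y

open FreeAlgebra in
/-- The relation `x y = q y x` of the quantum plane. -/
inductive PlaneRel (q : Param) : FreeAlgebra ℂ PlaneGen → FreeAlgebra ℂ PlaneGen → Prop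
  | xy : PlaneRel q (ι ℂ PlaneGen.x * ι ℂ PlaneGen.y)
      (((q : ℝ) : ℂ) • (ι ℂ PlaneGen.y * ι ℂ PlaneGen.x))

/-- The quantum plane. -/
def Plane (q : Param) : Type := RingQuot (PlaneRel q)

noncomputable instance (q : Param) : Ring (Plane q) :=
  inferInstanceAs (Ring (RingQuot (PlaneRel q)))

noncomputable instance (q : Param) : Algebra ℂ (Plane q) :=
  inferInstanceAs (Algebra ℂ (RingQuot (PlaneRel q)))

/-- The class of a generator of the quantum plane. -/
noncomputable def planeGen (q : Param) (g : PlaneGen) : Plane q :=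
  RingQuot.mkAlgHom ℂ (PlaneRel q) (FreeAlgebra.ι ℂ g)

theorem planeGen_xy (q : Param) :
    planeGen q .x * planeGen q .y = ((q : ℝ) : ℂ) • (planeGen q .y * planeGen q .x) := by
  have := RingQuot.mkAlgHom_rel ℂ (PlaneRel.xy (q := q))
  rw [map_smul, map_mul, map_mul] at this
  exact this

/-- The right coaction on generators, `R x = x ⊗ a + y ⊗ c`, `R y = x ⊗ b + y ⊗ d`. -/
noncomputable def coactionGen (q : Param) : PlaneGen → Plane q ⊗[ℂ] Coord q
  | .x => planeGen q .x ⊗ₜ gen q .a + planeGen q .y ⊗ₜ gen q .c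
  | .y => planeGen q .x ⊗ₜ gen q .b + planeGen q .y ⊗ₜ gen q .d

/-- The right coaction of `SU_q(2)` on the quantum plane. -/
noncomputable def coaction (q : Param) : Plane q →ₐ[ℂ] Plane q ⊗[ℂ] Coord q :=
  RingQuot.liftAlgHom ℂ ⟨FreeAlgebra.lift ℂ (coactionGen q), by
    rintro _ _ ⟨⟩
    have h0 := Param.ne_zero q
    simp only [map_mul, map_smul, FreeAlgebra.lift_ι_apply, coactionGen, mul_add, add_mul,
      Algebra.TensorProduct.tmul_mul_tmul, gen_ab, gen_cd,
      gen_ad, gen_da, gen_bc, planeGen_xy, TensorProduct.tmul_add,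
      TensorProduct.tmul_smul, ← TensorProduct.smul_tmul', smul_add, smul_smul]
    match_scalars <;> (try field_simp)⟩

theorem coaction_gen (q : Param) (g : PlaneGen) :
    coaction q (planeGen q g) = coactionGen q g := by
  unfold coaction planeGen
  exact (RingQuot.liftAlgHom_mkAlgHom_apply ℂ _ _ _).trans (FreeAlgebra.lift_ι_apply _ _)

/-- If `w` lists the coefficients of `∑ᵢ x^(n-i) y^i ⊗ wᵢ`, this lists the coefficients of its
product with `x ⊗ u + y ⊗ v`. -/
noncomputable def stepRow (q : Param) (u v : Coord q) (w : ℕ → Coord q) : ℕ → Coord q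
  | 0 => w 0 * u
  | i + 1 => (((q : ℝ) : ℂ)⁻¹) ^ (i + 1) • (w (i + 1) * u) + w i * v

/-- The coefficients of `R(x^k y^j) = ∑ᵢ x^(k+j-i) y^i ⊗ rowCoef k j i`. -/
noncomputable def rowCoef (q : Param) (k j : ℕ) : ℕ → Coord q :=
  (stepRow q (gen q .b) (gen q .d))^[j]
    ((stepRow q (gen q .a) (gen q .c))^[k] (Pi.single 0 1))

theorem plane_yx (q : Param) (i : ℕ) : planeGen q .y ^ i * planeGen q .x =
    (((q : ℝ) : ℂ)⁻¹) ^ i • (planeGen q .x * planeGen q .y ^ i) := by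
  have h0 := Param.ne_zero q
  have h : planeGen q .y * planeGen q .x =
      ((q : ℝ) : ℂ)⁻¹ • (planeGen q .x * planeGen q .y) := by
    rw [planeGen_xy, smul_smul, inv_mul_cancel₀ h0, one_smul]
  induction i with
  | zero => simp
  | succ n ih =>
    rw [pow_succ, mul_assoc, h, mul_smul_comm, ← mul_assoc, ih, smul_mul_assoc, smul_smul,
      mul_assoc, ← pow_succ, ← pow_succ', pow_succ]

theorem stepRow_spec (q : Param) (u v : Coord q) (w : ℕ → Coord q) (n : ℕ)
    (hw : ∀ i, n < i → w i = 0) :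
    (∑ i ∈ Finset.range (n + 1), (planeGen q .x ^ (n - i) * planeGen q .y ^ i) ⊗ₜ[ℂ] w i) *
        (planeGen q .x ⊗ₜ u + planeGen q .y ⊗ₜ v) =
      (∑ i ∈ Finset.range (n + 2),
        (planeGen q .x ^ (n + 1 - i) * planeGen q .y ^ i) ⊗ₜ[ℂ] stepRow q u v w i) ∧
    ∀ i, n + 1 < i → stepRow q u v w i = 0 := by
  constructor
  · have h1 : ∀ i ∈ Finset.range (n + 1), (planeGen q .x ^ (n - i) * planeGen q .y ^ i) ⊗ₜ[ℂ] w i *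
        (planeGen q .x ⊗ₜ u + planeGen q .y ⊗ₜ v) =
        (planeGen q .x ^ (n + 1 - i) * planeGen q .y ^ i) ⊗ₜ[ℂ]
          ((((q : ℝ) : ℂ)⁻¹) ^ i • (w i * u)) +
        (planeGen q .x ^ (n + 1 - (i + 1)) * planeGen q .y ^ (i + 1)) ⊗ₜ[ℂ] (w i * v) := by
      intro i hi
      have hi' : n + 1 - i = (n - i) + 1 := by have := Finset.mem_range.1 hi; omega
      rw [mul_add, Algebra.TensorProduct.tmul_mul_tmul, Algebra.TensorProduct.tmul_mul_tmul,
        mul_assoc, plane_yx, mul_smul_comm, ← mul_assoc, ← pow_succ, mul_assoc, ← pow_succ,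
        TensorProduct.tmul_smul, TensorProduct.smul_tmul', hi', Nat.add_sub_add_right]
    rw [Finset.sum_mul, Finset.sum_congr rfl h1, Finset.sum_add_distrib]
    have h2 : ∑ i ∈ Finset.range (n + 1), (planeGen q .x ^ (n + 1 - i) * planeGen q .y ^ i) ⊗ₜ[ℂ]
          ((((q : ℝ) : ℂ)⁻¹) ^ i • (w i * u)) =
        ∑ i ∈ Finset.range (n + 2), (planeGen q .x ^ (n + 1 - i) * planeGen q .y ^ i) ⊗ₜ[ℂ]
          ((((q : ℝ) : ℂ)⁻¹) ^ i • (w i * u)) := by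
      rw [Finset.sum_range_succ _ (n + 1), hw (n + 1) (Nat.lt_succ_self n)]; simp
    rw [h2, Finset.sum_range_succ' _ (n + 1), Finset.sum_range_succ' _ (n + 1),
      add_right_comm, ← Finset.sum_add_distrib]
    simp only [← TensorProduct.tmul_add, stepRow, pow_zero, one_smul]
  · intro i hi
    obtain ⟨i, rfl⟩ := Nat.exists_eq_succ_of_ne_zero (Nat.ne_zero_of_lt hi)
    rw [stepRow, hw (i + 1) (by omega), hw i (by omega)]; simp

theorem coaction_monomial (q : Param) (k j : ℕ) :
    coaction q (planeGen q .x ^ k * planeGen q .y ^ j) =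
      (∑ i ∈ Finset.range (k + j + 1),
        (planeGen q .x ^ (k + j - i) * planeGen q .y ^ i) ⊗ₜ[ℂ] rowCoef q k j i) ∧
    ∀ i, k + j < i → rowCoef q k j i = 0 := by
  induction j with
  | zero =>
    induction k with
    | zero =>
      refine ⟨by simp [rowCoef, Algebra.TensorProduct.one_def], fun i hi => ?_⟩
      simp [rowCoef, Nat.ne_zero_of_lt hi]
    | succ k ih =>
      obtain ⟨ih1, ih2⟩ := ih
      have hs := stepRow_spec q (gen q .a) (gen q .c) _ (k + 0) ih2
      have hr : rowCoef q (k + 1) 0 = stepRow q (gen q .a) (gen q .c) (rowCoef q k 0) := by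
        simp only [rowCoef, Function.iterate_zero, id, Function.iterate_succ_apply']
      rw [hr]
      refine ⟨?_, hs.2⟩
      rw [← ih1] at hs
      refine Eq.trans ?_ hs.1
      rw [pow_zero, mul_one, mul_one, pow_succ, map_mul, coaction_gen]; rfl
  | succ j ih =>
    obtain ⟨ih1, ih2⟩ := ih
    have hs := stepRow_spec q (gen q .b) (gen q .d) _ (k + j) ih2
    have hr : rowCoef q k (j + 1) = stepRow q (gen q .b) (gen q .d) (rowCoef q k j) := by
      simp only [rowCoef, Function.iterate_succ_apply']
    rw [hr]
    refine ⟨?_, hs.2⟩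
    rw [← ih1] at hs
    refine Eq.trans ?_ hs.1
    rw [pow_succ, ← mul_assoc, map_mul, coaction_gen]; rfl

/-- The Gaussian binomial coefficient. -/
noncomputable def gaussBinom (p : ℝ) (n k : ℕ) : ℝ :=
  ∏ s ∈ Finset.range k, (1 - p ^ (n - s)) / (1 - p ^ (s + 1))

/-- The normalization of the monomials that makes the corepresentations unitary. -/
noncomputable def normalizer (q : Param) (n k : ℕ) : ℝ := √(gaussBinom ((q : ℝ) ^ 2)⁻¹ n k)

theorem normalizer_pos (q : Param) {n k : ℕ} (h : k ≤ n) : 0 < normalizer q n k := by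
  have hp : 1 < ((q : ℝ) ^ 2)⁻¹ :=
    (one_lt_inv₀ (pow_pos q.2.1 _)).2 (pow_lt_one₀ q.2.1.le q.2.2 two_ne_zero)
  refine Real.sqrt_pos.2 (Finset.prod_pos fun s hs => ?_)
  have hs' := Finset.mem_range.1 hs
  exact div_pos_of_neg_of_neg (sub_neg.2 (one_lt_pow₀ hp (by omega)))
    (sub_neg.2 (one_lt_pow₀ hp (by omega)))

/-- The normalized basis of the polynomials of degree `n = 2l` in the quantum plane; `k` stands
for the index `-l + k`. -/
noncomputable def planeBasis (q : Param) (n : ℕ) (k : Fin (n + 1)) : Plane q :=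
  (normalizer q n k : ℂ) • (planeGen q .x ^ (n - k : ℕ) * planeGen q .y ^ (k : ℕ))

/-- The matrix coefficients of the irreducible corepresentation `T^(l)`, `n = 2l`; the indices
`i j` stand for `-l + i`, `-l + j`. See `coaction_planeBasis`. -/
noncomputable def matCoef (q : Param) (n : ℕ) (i j : Fin (n + 1)) : Coord q :=
  ((normalizer q n j / normalizer q n i : ℝ) : ℂ) • rowCoef q (n - j) j i

theorem coaction_planeBasis (q : Param) (n : ℕ) (j : Fin (n + 1)) :
    coaction q (planeBasis q n j) = ∑ i, planeBasis q n i ⊗ₜ[ℂ] matCoef q n i j := by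
  have h := (coaction_monomial q (n - j) j).1
  rw [Nat.sub_add_cancel (Nat.lt_succ_iff.1 j.2), Finset.sum_range] at h
  rw [planeBasis, map_smul, h, Finset.smul_sum]
  refine Finset.sum_congr rfl fun i _ => ?_
  have hi : (normalizer q n i : ℂ) ≠ 0 := by
    exact_mod_cast (normalizer_pos q (Nat.lt_succ_iff.1 i.2)).ne'
  rw [planeBasis, matCoef, TensorProduct.tmul_smul, ← TensorProduct.smul_tmul', smul_smul]
  congr 1
  push_cast
  field_simp

/-! ### Fourier transform and pseudo-differential operators

A half-integer `l ∈ ½ℕ` is encoded by `n = 2l : ℕ`, and an index `-l ≤ i ≤ l` by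
`i + l ∈ {0, …, n}`. -/

/-- The `q`-number `[n]_q`. -/
noncomputable def qNumber (q : Param) (n : ℕ) : ℂ :=
  ((((q : ℝ) ^ n - ((q : ℝ)⁻¹) ^ n) / ((q : ℝ) - (q : ℝ)⁻¹) : ℝ) : ℂ)

/-- The Fourier transform `f̂(l)_{rs} = h(f (t_{sr})*)`. -/
noncomputable def fourier (q : Param) (n : ℕ) :
    L2 q →ₗ[ℂ] Matrix (Fin (n + 1)) (Fin (n + 1)) ℂ where
  toFun f := Matrix.of fun r s => inner ℂ (toL2 q (matCoef q n s r)) f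
  map_add' f g := by ext; simp [inner_add_right]
  map_smul' z f := by ext; simp [inner_smul_right]

theorem fourier_toL2 (q : Param) (n : ℕ) (f : Coord q) (r s : Fin (n + 1)) :
    fourier q n (toL2 q f) r s = haar q (f * star (matCoef q n s r)) := inner_toL2 q _ _

/-- The quantum trace `Tr_q(A) = ∑ⱼ q^(-2j) A_{jj}`, over `-l ≤ j ≤ l`. -/
noncomputable def qTrace (q : Param) (n : ℕ) :
    Matrix (Fin (n + 1)) (Fin (n + 1)) (Coord q) →ₗ[ℂ] Coord q where
  toFun A := ∑ j : Fin (n + 1), ((q : ℝ) : ℂ) ^ ((n : ℤ) - 2 * (j : ℕ)) • A j j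
  map_add' A B := by simp [Finset.sum_add_distrib, -Complex.coe_smul]
  map_smul' z A := by
    simp only [Matrix.smul_apply, RingHom.id_apply, Finset.smul_sum]
    exact Finset.sum_congr rfl fun j _ => smul_comm _ _ _

/-- A symbol: for each `l`, a matrix of size `2l + 1` over the coordinate algebra. -/
abbrev Symbol (q : Param) : Type :=
  (n : ℕ) → Matrix (Fin (n + 1)) (Fin (n + 1)) (Coord q)

/-- The term of `T_σ f` of index `l`, `[2l+1]_q Tr_q(σ(l) f̂(l) T^(l))`. -/
noncomputable def symbolTerm {q : Param} (σ : Symbol q) (f : L2 q) (n : ℕ) : L2 q :=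
  toL2 q (qNumber q (n + 1) •
    qTrace q n (σ n * (fourier q n f).map (algebraMap ℂ (Coord q)) * Matrix.of (matCoef q n)))

theorem symbolTerm_add {q : Param} (σ : Symbol q) (f g : L2 q) (n : ℕ) :
    symbolTerm σ (f + g) n = symbolTerm σ f n + symbolTerm σ g n := by
  have : (fourier q n (f + g)).map (algebraMap ℂ (Coord q)) =
      (fourier q n f).map (algebraMap ℂ (Coord q)) +
        (fourier q n g).map (algebraMap ℂ (Coord q)) := by
    rw [map_add, Matrix.map_add _ (map_add _)]
  rw [symbolTerm, this, Matrix.mul_add, Matrix.add_mul, map_add, smul_add, map_add]; rfl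

theorem symbolTerm_smul {q : Param} (σ : Symbol q) (z : ℂ) (f : L2 q) (n : ℕ) :
    symbolTerm σ (z • f) n = z • symbolTerm σ f n := by
  have : (fourier q n (z • f)).map (algebraMap ℂ (Coord q)) =
      z • (fourier q n f).map (algebraMap ℂ (Coord q)) := by
    ext i j
    rw [map_smul, Matrix.map_apply, Matrix.smul_apply, Matrix.smul_apply, Matrix.map_apply,
      smul_eq_mul, map_mul, ← Algebra.smul_def]
  rw [symbolTerm, this, Matrix.mul_smul, Matrix.smul_mul, map_smul (qTrace q n),
    smul_comm, map_smul (toL2 q) z]; rfl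

/-- The global pseudo-differential operator `T_σ f = ∑_l [2l+1]_q Tr_q(σ(l) f̂(l) T^(l))`,
that is, the inverse Fourier transform of `σ f̂`, on the domain of all `f` for which the series
converges. -/
noncomputable def psiDO {q : Param} (σ : Symbol q) : L2 q →ₗ.[ℂ] L2 q where
  domain :=
    { carrier := {f | Summable (symbolTerm σ f)}
      zero_mem' := by
        have : symbolTerm σ (0 : L2 q) = 0 := by
          ext1 n
          rw [← zero_smul ℂ (0 : L2 q), symbolTerm_smul, zero_smul]; rfl
        show Summable (symbolTerm σ (0 : L2 q))
        rw [this]; exact summable_zero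
      add_mem' := fun {f g} hf hg => by
        show Summable (symbolTerm σ (f + g))
        rw [show symbolTerm σ (f + g) = symbolTerm σ f + symbolTerm σ g from
          funext fun n => symbolTerm_add σ f g n]
        exact Summable.add hf hg
      smul_mem' := fun z f hf => by
        show Summable (symbolTerm σ (z • f))
        rw [show symbolTerm σ (z • f) = z • symbolTerm σ f from
          funext fun n => symbolTerm_smul σ z f n]
        exact Summable.const_smul z hf }
  toFun :=
    { toFun := fun f => ∑' n, symbolTerm σ (f : L2 q) n
      map_add' := fun f g => by
        simp only [Submodule.coe_add, symbolTerm_add]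
        exact Summable.tsum_add f.2 g.2
      map_smul' := fun z f => by
        simp only [Submodule.coe_smul, symbolTerm_smul, RingHom.id_apply]
        exact Summable.tsum_const_smul z f.2 }

/-- Homogeneous symbols of Fourier order `m / 2`: each entry `σ(l)_{ij}` is a multiple of
`t^(m/2)_{ψ(l)(i,j)}` for a map `ψ(l)` to pairs of half-integers (here doubled), and zero if
`ψ(l)(i,j)` is not a pair of indices of `T^(m/2)`. -/
def IsHomogeneous {q : Param} (m : ℕ) (σ : Symbol q) : Prop :=
  ∃ ψ : (n : ℕ) → Fin (n + 1) × Fin (n + 1) → ℤ × ℤ, ∀ (n : ℕ) (i j : Fin (n + 1)),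
    (∀ r s : Fin (m + 1), ψ n (i, j) = (2 * (r : ℤ) - m, 2 * (s : ℤ) - m) →
      σ n i j ∈ Submodule.span ℂ {matCoef q m r s}) ∧
    ((∀ r s : Fin (m + 1), ψ n (i, j) ≠ (2 * (r : ℤ) - m, 2 * (s : ℤ) - m)) → σ n i j = 0)

/-- The class `Φ^(m/2)` of symbols of Fourier order `m / 2`: finite linear combinations of
homogeneous symbols. -/
noncomputable def symbolClass (q : Param) (m : ℕ) : Submodule ℂ (Symbol q) :=
  Submodule.span ℂ {σ | IsHomogeneous m σ}

/-! ### Spectrum and multiplicity -/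

/-- The spectrum of a partially defined operator: `z` is outside of it if `T - z` has a bounded
everywhere defined inverse. -/
def pmapSpectrum {H : Type*} [NormedAddCommGroup H] [NormedSpace ℂ H] (T : H →ₗ.[ℂ] H) : Set ℂ :=
  {z | ¬ ∃ R : H →L[ℂ] H,
    (∀ g, ∃ hg : R g ∈ T.domain, T ⟨R g, hg⟩ - z • R g = g) ∧
    ∀ f : T.domain, R (T f - z • (f : H)) = f}

/-- The eigenspace `ker (T - z)` of a partially defined operator. -/
def pmapEigenspace {H : Type*} [NormedAddCommGroup H] [NormedSpace ℂ H] (T : H →ₗ.[ℂ] H) (z : ℂ) :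
    Submodule ℂ H :=
  (LinearMap.ker (T.toFun - z • T.domain.subtype)).map T.domain.subtype

theorem mem_pmapEigenspace {H : Type*} [NormedAddCommGroup H] [NormedSpace ℂ H]
    (T : H →ₗ.[ℂ] H) (z : ℂ) (f : H) :
    f ∈ pmapEigenspace T z ↔ ∃ hf : f ∈ T.domain, T ⟨f, hf⟩ = z • f := by
  constructor
  · rintro ⟨⟨g, hg⟩, hgz, rfl⟩
    exact ⟨hg, sub_eq_zero.1 hgz⟩
  · rintro ⟨hf, h⟩
    exact ⟨⟨f, hf⟩, sub_eq_zero.2 h, rfl⟩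

end SUq2

/-! Put n = 2l. For each row s of T^(l), the vector v_s = ∑ₘ q^(n-2m) t_{sm} (`rowVector`) is an
eigenvector for λ(l). The reason is orthogonality: h(t_{ij} t_{i'j'}*) vanishes unless the two
coefficients coincide, and h(t_{ij} t_{ij}*) = q^(2j-n)/[n+1]_q does not depend on i. The weights of
v_s cancel these powers of q, so v̂_s vanishes away from l, and [n+1]_q v̂_s(l) has ones in column s
and zeros elsewhere (`qNumber_mul_fourier_rowVector`).

Left multiplication by σ(l) replaces these ones by the row sums of σ(l), all equal to λ(l). Hence σ
v̂_s = λ(l) v̂_s, the series for T_σ v_s has one possibly nonzero term, and the quantum trace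
restores the weights: T_σ v_s = λ(l) v_s. The n+1 vectors v_s are told apart by their Fourier
coefficients, so they are independent, and an eigenvalue lies in the spectrum.

The work is in the orthogonality relations (`haar_matCoef_of_ne`, `haar_matCoef_self`). They come
from the infinitesimal invariance h ∘ E = 0 (`haar_deriv`). The operator E turns x into y, hence
moves one column of T^(l) to the next, and on adjoints it moves back. Applied to a product of a
coefficient and an adjoint, h ∘ E = 0 lowers both column indices by one (`rowInner_succ`). In column
0 the coefficients are multiples of a^(n-i) c^i, and the Haar functional of the resulting monomials
is explicit (`haar_mon_eq_zero`, `haar_mon_diag`). -/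

namespace SUq2

/-! ### Action of the torus automorphism and of the twisted derivation E on the rows R(x^k y^j) -/

section MatrixCoefficients
variable (q : Param)

theorem stepRow_smul (u v : Coord q) (z : ℂ) (w : ℕ → Coord q) :
    stepRow q u v (z • w) = z • stepRow q u v w := by
  ext i
  cases i with
  | zero => simp only [stepRow, Pi.smul_apply, smul_mul_assoc]
  | succ i =>
    simp only [stepRow, Pi.smul_apply, smul_mul_assoc, smul_add]
    rw [smul_comm]

/-- `stepRow` with `a, c` is right multiplication by R(x), and with `b, d` by R(y), so this is R(y)
R(x) = q⁻¹ R(x) R(y). It is checked on coefficients, which avoids any appeal to independence of the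
monomials x^i y^j. -/
theorem stepRow_ac_bd (w : ℕ → Coord q) :
    stepRow q (gen q .a) (gen q .c) (stepRow q (gen q .b) (gen q .d) w) =
      ((q : ℝ) : ℂ)⁻¹ • stepRow q (gen q .b) (gen q .d) (stepRow q (gen q .a) (gen q .c) w) := by
  have h0 := Param.ne_zero q
  have hba := gen_inv_comm (gen_ab q)
  have hdc := gen_inv_comm (gen_cd q)
  ext i
  rcases i with _ | _ | i
  · simp only [stepRow, Pi.smul_apply, mul_assoc, hba, mul_smul_comm]
  all_goals
    simp only [stepRow, Pi.smul_apply, mul_assoc, hba, hdc, gen_da, gen_ad, gen_bc, add_mul,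
      mul_add, mul_one, smul_mul_assoc, mul_smul_comm, inv_pow]
    match_scalars
    all_goals field_simp
    all_goals ring

theorem rowCoef_succ_right (k j : ℕ) :
    rowCoef q k (j + 1) = stepRow q (gen q .b) (gen q .d) (rowCoef q k j) := by
  simp only [rowCoef, Function.iterate_succ_apply']

theorem rowCoef_succ_left (k : ℕ) :
    rowCoef q (k + 1) 0 = stepRow q (gen q .a) (gen q .c) (rowCoef q k 0) := by
  simp only [rowCoef, Function.iterate_zero, id, Function.iterate_succ_apply']

/-- R(x) has to pass j factors R(y) to reach the other factors R(x), and each passage costs q⁻¹. -/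
theorem stepRow_ac_rowCoef (k j : ℕ) :
    stepRow q (gen q .a) (gen q .c) (rowCoef q k j) =
      ((q : ℝ) : ℂ)⁻¹ ^ j • rowCoef q (k + 1) j := by
  induction j with
  | zero => rw [← rowCoef_succ_left, pow_zero, one_smul]
  | succ j ih =>
    rw [rowCoef_succ_right, stepRow_ac_bd, ih, stepRow_smul, smul_smul, ← pow_succ',
      rowCoef_succ_right]

theorem kAut_stepRow {u v : Coord q} {w : ℕ → Coord q} {y z : ℂ} (hu : kAut q u = y • u)
    (hv : kAut q v = y • v) (hw : ∀ i, kAut q (w i) = z • w i) (i : ℕ) :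
    kAut q (stepRow q u v w i) = (z * y) • stepRow q u v w i := by
  cases i <;> simp only [stepRow, map_add, map_mul, map_smul, hu, hv, hw, smul_mul_smul_comm,
    smul_add]
  rw [smul_comm]

theorem kAut_rowCoef (k j i : ℕ) : kAut q (rowCoef q k j i) =
    (((q : ℝ) : ℂ) ^ k * ((q : ℝ) : ℂ)⁻¹ ^ j) • rowCoef q k j i := by
  obtain ⟨ka, kb, kc, kd⟩ := kAut_gen q
  induction j generalizing i with
  | zero =>
    induction k generalizing i with
    | zero =>
      rcases i with _ | i <;> simp [rowCoef]
    | succ k ih =>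
      rw [rowCoef_succ_left, kAut_stepRow q ka kc ih]
      congr 1; ring
  | succ j ih =>
    rw [rowCoef_succ_right, kAut_stepRow q kb kd ih, pow_succ, mul_assoc]

theorem deriv_stepRow_bd {w w' : ℕ → Coord q} (hw : ∀ i, deriv q (w i) = w' i) (i : ℕ) :
    deriv q (stepRow q (gen q .b) (gen q .d) w i) = stepRow q (gen q .b) (gen q .d) w' i := by
  obtain ⟨-, eb, -, ed⟩ := deriv_gen q
  cases i <;> simp only [stepRow, map_add, map_smul, deriv_mul, eb, ed, hw, mul_zero, zero_add]

theorem deriv_stepRow_ac {w w' : ℕ → Coord q} {z : ℂ} (hk : ∀ i, kAut q (w i) = z • w i)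
    (hw : ∀ i, deriv q (w i) = w' i) (i : ℕ) :
    deriv q (stepRow q (gen q .a) (gen q .c) w i) =
      z • stepRow q (gen q .b) (gen q .d) w i + stepRow q (gen q .a) (gen q .c) w' i := by
  obtain ⟨ea, -, ec, -⟩ := deriv_gen q
  cases i <;> simp only [stepRow, map_add, map_smul, deriv_mul, ea, ec, hw, hk, smul_mul_assoc]
  module

/-- Mirror image of the defining recursion, from the symmetry of `num` under q ↔ q⁻¹. It is the form
that the Leibniz rule produces in `deriv_rowCoef`. -/
theorem num_succ' (k : ℕ) : num q (k + 1) = (q : ℝ) ^ k + (q : ℝ)⁻¹ * num q k := by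
  induction k with
  | zero => simp [num]
  | succ k ih =>
    have h1 : num q (k + 1 + 1) = (q : ℝ) * num q (k + 1) + (q : ℝ)⁻¹ ^ (k + 1) := rfl
    have h2 : num q (k + 1) = (q : ℝ) * num q k + (q : ℝ)⁻¹ ^ k := rfl
    linear_combination h1 + (q : ℝ) * ih - (q : ℝ)⁻¹ * h2

/-- E sends `a, c` to `b, d` and kills `b, d`, so it replaces one factor R(x) by R(y). The twist by
`kAut` and the reordering of factors add the k contributions up to a q-number. -/
theorem deriv_rowCoef (k j i : ℕ) : deriv q (rowCoef q k j i) =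
    (num q k : ℂ) • rowCoef q (k - 1) (j + 1) i := by
  induction j generalizing i with
  | zero =>
    induction k generalizing i with
    | zero =>
      rcases i with _ | i <;> simp [rowCoef, num, deriv_one]
    | succ k ih =>
      rw [rowCoef_succ_left, deriv_stepRow_ac q (w' := (num q k : ℂ) • rowCoef q (k - 1) 1)
        (kAut_rowCoef q k 0) ih, stepRow_smul, num_succ', stepRow_ac_rowCoef]
      -- The truncated k - 1 satisfies k - 1 + 1 = k only for k > 0; at k = 0 the offending term
      -- carries the factor `num q 0 = 0`.
      rcases k with _ | k
      · rw [Pi.smul_apply, ← rowCoef_succ_right]; simp [num]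
      · rw [Nat.add_sub_cancel, Nat.add_sub_cancel, Pi.smul_apply, Pi.smul_apply,
          ← rowCoef_succ_right, zero_add]
        push_cast
        module
  | succ j ih =>
    rw [rowCoef_succ_right, deriv_stepRow_bd q (w' := (num q k : ℂ) • rowCoef q (k - 1) (j + 1))
      ih, stepRow_smul, Pi.smul_apply, ← rowCoef_succ_right]

/-! ### The twisted derivation on adjoints of the rows -/

theorem star_stepRow (u v : Coord q) (w : ℕ → Coord q) (i : ℕ) :
    star (stepRow q u v w (i + 1)) =
      ((q : ℝ) : ℂ)⁻¹ ^ (i + 1) • (star u * star (w (i + 1))) + star v * star (w i) := by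
  rw [stepRow, star_add, star_smul, star_mul, star_mul]
  congr 2
  simp [Complex.conj_ofReal]

theorem deriv_star_stepRow_ac {w w' : ℕ → Coord q} (hw : ∀ i, deriv q (star (w i)) = star (w' i))
    (i : ℕ) : deriv q (star (stepRow q (gen q .a) (gen q .c) w i)) =
      ((q : ℝ) : ℂ)⁻¹ • star (stepRow q (gen q .a) (gen q .c) w' i) := by
  obtain ⟨-, eb, -, ed⟩ := deriv_gen q
  obtain ⟨-, kb, -, kd⟩ := kAut_gen q
  cases i <;> [simp only [stepRow, star_mul]; simp only [star_stepRow]] <;>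
    simp only [star_gen, genStar, map_add, map_smul, deriv_mul, eb, ed, kb, kd, hw, zero_mul,
      add_zero, smul_mul_assoc, smul_add]
  module

/-- Here E(b*) = -q a* and E(d*) = -q c*, so on adjoints E turns R(y) back into R(x), with factor
-q. The other term is the twist: `kAut` scales b* and d* by q. -/
theorem deriv_star_stepRow_bd {w w' : ℕ → Coord q} (hw : ∀ i, deriv q (star (w i)) = star (w' i))
    (i : ℕ) : deriv q (star (stepRow q (gen q .b) (gen q .d) w i)) =
      ((q : ℝ) : ℂ) • star (stepRow q (gen q .b) (gen q .d) w' i) -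
        ((q : ℝ) : ℂ) • star (stepRow q (gen q .a) (gen q .c) w i) := by
  have h0 := Param.ne_zero q
  obtain ⟨ea, -, ec, -⟩ := deriv_gen q
  obtain ⟨ka, -, kc, -⟩ := kAut_gen q
  cases i <;> [simp only [stepRow, star_mul]; simp only [star_stepRow]] <;>
    simp only [star_gen, genStar, map_add, map_smul, deriv_mul, ea, ec, ka, kc, hw,
      smul_mul_assoc, smul_add] <;>
    match_scalars <;> field_simp

/-- Dual to `deriv_rowCoef`: each of the j factors R(y) is turned into R(x) in turn. The
contributions satisfy the defining recursion of `num`. -/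
theorem deriv_star_rowCoef (k j i : ℕ) : deriv q (star (rowCoef q k j i)) =
    (-((q : ℝ) : ℂ) * num q j) • star (rowCoef q (k + 1) (j - 1) i) := by
  have hs : ∀ (r : ℝ) (x : Coord q), star ((r : ℂ) • x) = (r : ℂ) • star x := fun r x => by
    rw [star_smul', Complex.conj_ofReal]
  induction j generalizing i with
  | zero =>
    -- For j = 0 only adjoints of `a` and `c` occur; these are multiples of `d` and `b`, which E
    -- kills.
    rw [num, Complex.ofReal_zero, mul_zero, zero_smul]
    induction k generalizing i with
    | zero => rcases i with _ | i <;> simp [rowCoef, deriv_one]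
    | succ k ih =>
      rw [rowCoef_succ_left, deriv_star_stepRow_ac q (w' := 0) (fun i => by rw [ih]; simp)]
      cases i <;> simp [stepRow]
  | succ j ih =>
    have ih' : ∀ i, deriv q (star (rowCoef q k j i)) =
        star ((((-(q : ℝ) * num q j : ℝ) : ℂ) • rowCoef q (k + 1) (j - 1)) i) := fun i => by
      rw [ih, Pi.smul_apply, hs]; push_cast; rfl
    rw [rowCoef_succ_right, deriv_star_stepRow_bd q ih', stepRow_smul, stepRow_ac_rowCoef,
      Pi.smul_apply, hs, Pi.smul_apply,
      show ((q : ℝ) : ℂ)⁻¹ ^ j = (((q : ℝ)⁻¹ ^ j : ℝ) : ℂ) by push_cast; rfl, hs,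
      ← rowCoef_succ_right, num, Nat.add_sub_cancel]
    rcases j with _ | j
    · simp only [num]
      push_cast
      module
    · rw [Nat.add_sub_cancel]
      push_cast
      module

end MatrixCoefficients
-- Gaussian binomial coefficients
section GaussBinom

theorem gaussBinom_succ {p : ℝ} (hp : 1 < p) (n k : ℕ) :
    gaussBinom p n (k + 1) * (1 - p ^ (k + 1)) = gaussBinom p n k * (1 - p ^ (n - k)) := by
  have h : 1 - p ^ (k + 1) ≠ 0 := (sub_neg.2 (one_lt_pow₀ hp k.succ_ne_zero)).ne
  rw [gaussBinom, Finset.prod_range_succ, mul_assoc, div_mul_cancel₀ _ h, gaussBinom]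

theorem gaussBinom_succ_succ {p : ℝ} (hp : 1 < p) (n k : ℕ) :
    gaussBinom p (n + 1) (k + 1) * (1 - p ^ (k + 1)) = gaussBinom p n k * (1 - p ^ (n + 1)) := by
  have h : 1 - p ^ (k + 1) ≠ 0 := (sub_neg.2 (one_lt_pow₀ hp k.succ_ne_zero)).ne
  rw [gaussBinom, gaussBinom, Finset.prod_div_distrib, Finset.prod_div_distrib,
    Finset.prod_range_succ', Finset.prod_range_succ _ k]
  simp only [Nat.add_sub_add_right, Nat.sub_zero]
  field_simp

/-- The factor s = n of the product has numerator 1 - p^0. -/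
theorem gaussBinom_eq_zero {p : ℝ} {n k : ℕ} (h : n < k) : gaussBinom p n k = 0 :=
  Finset.prod_eq_zero (Finset.mem_range.2 h) (by simp)

theorem gaussBinom_pascal {p : ℝ} (hp : 1 < p) (n k : ℕ) :
    gaussBinom p (n + 1) (k + 1) = p ^ (k + 1) * gaussBinom p n (k + 1) + gaussBinom p n k := by
  have h : 1 - p ^ (k + 1) ≠ 0 := (sub_neg.2 (one_lt_pow₀ hp k.succ_ne_zero)).ne
  have h1 := gaussBinom_succ_succ hp n k
  have h2 := gaussBinom_succ hp n k
  -- The exponent n - k is a truncated difference, so the splitting of p^(n+1) is available only for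
  -- k ≤ n; otherwise all three coefficients vanish.
  rcases lt_or_ge n k with hk | hk
  · rw [gaussBinom_eq_zero hk, gaussBinom_eq_zero (show n < k + 1 by omega),
      gaussBinom_eq_zero (show n + 1 < k + 1 by omega)]
    ring
  · have h3 : p ^ (n + 1) = p ^ (k + 1) * p ^ (n - k) := by
      rw [← pow_add]; congr 1; omega
    refine mul_right_cancel₀ h ?_
    linear_combination h1 - p ^ (k + 1) * h2 - gaussBinom p n k * h3

theorem gaussBinom_self {p : ℝ} (hp : 1 < p) (n : ℕ) : gaussBinom p n n = 1 := by
  induction n with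
  | zero => simp [gaussBinom]
  | succ n ih =>
    have h : 1 - p ^ (n + 1) ≠ 0 := (sub_neg.2 (one_lt_pow₀ hp n.succ_ne_zero)).ne
    have := gaussBinom_succ_succ hp n n
    rw [ih] at this
    exact mul_right_cancel₀ h this

end GaussBinom

/-! ### Recursion for the inner products of the coefficients -/

section Orthogonality
variable (q : Param)

theorem one_lt_inv_sq : 1 < ((q : ℝ) ^ 2)⁻¹ :=
  (one_lt_inv₀ (pow_pos q.2.1 _)).2 (pow_lt_one₀ q.2.1.le q.2.2 two_ne_zero)

/-- Converts the q-numbers produced by E into the factors 1 - p^(k+1), p = q⁻², of the Gaussian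
binomials. -/
theorem num_mul (k : ℕ) : num q (k + 1) * (1 - ((q : ℝ) ^ 2)⁻¹) =
    (q : ℝ) ^ k * (1 - ((q : ℝ) ^ 2)⁻¹ ^ (k + 1)) := by
  have h0 : (q : ℝ) ≠ 0 := q.2.1.ne'
  induction k with
  | zero => simp [num]
  | succ k ih =>
    have h1 : num q (k + 1 + 1) = (q : ℝ) * num q (k + 1) + (q : ℝ)⁻¹ ^ (k + 1) := rfl
    have h2 : (q : ℝ) ^ (k + 1) * ((q : ℝ) ^ 2)⁻¹ ^ (k + 1) = (q : ℝ)⁻¹ ^ (k + 1) := by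
      rw [← mul_pow]; congr 1; field_simp
    rw [h1]
    linear_combination (q : ℝ) * ih - (1 - ((q : ℝ) ^ 2)⁻¹) * h2

/-- The q-binomial theorem for (x ⊗ a + y ⊗ c)^k. The base is q⁻² because moving y past x and `c`
past `a` costs q⁻¹ each. -/
theorem rowCoef_zero_right (k i : ℕ) : rowCoef q k 0 i =
    (gaussBinom ((q : ℝ) ^ 2)⁻¹ k i : ℂ) • (gen q .a ^ (k - i) * gen q .c ^ i) := by
  induction k generalizing i with
  | zero =>
    rcases i with _ | i
    · simp [rowCoef, gaussBinom]
    · rw [gaussBinom_eq_zero (Nat.succ_pos i)]; simp [rowCoef]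
  | succ k ih =>
    rw [rowCoef_succ_left]
    rcases i with _ | i
    · simp [stepRow, ih, gaussBinom, pow_succ]
    · have hca : (gen q .a ^ (k - (i + 1)) * gen q .c ^ (i + 1)) * gen q .a =
          ((q : ℝ) : ℂ)⁻¹ ^ (i + 1) •
            (gen q .a ^ (k - (i + 1) + 1) * gen q .c ^ (i + 1)) := by
        rw [mul_assoc, pow_gen_ca, mul_smul_comm, ← mul_assoc, ← pow_succ]
      rw [stepRow, ih, ih, smul_mul_assoc, smul_mul_assoc, hca, mul_assoc _ _ (gen q .c),
        ← pow_succ, gaussBinom_pascal (one_lt_inv_sq q), Nat.add_sub_add_right]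
      -- At i ≥ k the truncated exponent k - (i + 1) is meaningless, but its Gaussian coefficient is
      -- zero.
      rcases lt_or_ge k (i + 1) with h | h
      · rw [gaussBinom_eq_zero h]; simp
      · rw [show k - (i + 1) + 1 = k - i by omega]
        have hp : (((q : ℝ) : ℂ) ^ 2)⁻¹ ^ (i + 1) =
            ((q : ℝ) : ℂ)⁻¹ ^ (i + 1) * ((q : ℝ) : ℂ)⁻¹ ^ (i + 1) := by
          rw [← mul_pow, ← mul_inv, sq]
        push_cast
        rw [hp]
        module

/-- The inner product `⟨rowCoef k' j' i', rowCoef k j i⟩`. -/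
noncomputable def rowInner (k j i k' j' i' : ℕ) : ℂ :=
  haar q (rowCoef q k j i * star (rowCoef q k' j' i'))

theorem conj_rowInner (k j i k' j' i' : ℕ) :
    conj (rowInner q k j i k' j' i') = rowInner q k' j' i' k j i := by
  rw [rowInner, ← haar_star, star_mul, star_star, rowInner]

/-- This is h(E(f g*)) = 0 with f = `rowCoef q (k + 1) j i` and g = `rowCoef q k' j' i'`, expanded
by the twisted Leibniz rule. It lowers the y-degrees of both arguments together and leaves i and i'
alone. -/
theorem rowInner_succ (k j i k' j' i' : ℕ) :
    (num q (k + 1) : ℂ) * rowInner q k (j + 1) i k' j' i' =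
      ((q : ℝ) : ℂ) ^ (k + 2) * ((q : ℝ) : ℂ)⁻¹ ^ j * num q j' *
        rowInner q (k + 1) j i (k' + 1) (j' - 1) i' := by
  have h := haar_deriv q (rowCoef q (k + 1) j i * star (rowCoef q k' j' i'))
  rw [deriv_mul, kAut_rowCoef, deriv_rowCoef, deriv_star_rowCoef, smul_mul_smul_comm,
    smul_mul_assoc, map_add, map_smul, map_smul, smul_eq_mul, smul_eq_mul,
    Nat.add_sub_cancel] at h
  simp only [rowInner]
  linear_combination h

/-- (a^(k'-i') c^i')* is a multiple of b^i' d^(k'-i'), so the product is already an ordered monomial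
`mon`. -/
theorem rowInner_zero_zero (k i k' i' : ℕ) : rowInner q k 0 i k' 0 i' =
    gaussBinom ((q : ℝ) ^ 2)⁻¹ k i * gaussBinom ((q : ℝ) ^ 2)⁻¹ k' i' *
      ((-((q : ℝ) : ℂ)⁻¹) ^ i' * haar q (mon q (k - i) i i' (k' - i'))) := by
  rw [rowInner, rowCoef_zero_right, rowCoef_zero_right, star_smul', Complex.conj_ofReal, star_mul,
    star_pow, star_pow, star_gen, star_gen, smul_mul_smul_comm, map_smul, smul_eq_mul]
  simp only [genStar]
  rw [smul_pow, smul_mul_assoc, mul_smul_comm, map_smul, smul_eq_mul, mon]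
  simp only [mul_assoc]

/-- The recursion lowers j and j' in step. If j ≠ j', one of them reaches 0 first and the factor
`num q 0` kills the product. If j = j', the descent ends at a monomial whose Haar functional
vanishes unless i = i' and k = k'. -/
theorem rowInner_eq_zero {k j i k' j' i' : ℕ} (hi : i ≤ k + j) (hi' : i' ≤ k' + j')
    (h : ¬ (k = k' ∧ j = j' ∧ i = i')) : rowInner q k j i k' j' i' = 0 := by
  -- The case where j' is exhausted first; the opposite case follows by complex conjugation.
  have right_zero : ∀ k j i k' i', rowInner q k (j + 1) i k' 0 i' = 0 := by
    intro k j i k' i'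
    have := rowInner_succ q k j i k' 0 i'
    rw [num, Complex.ofReal_zero, mul_zero, zero_mul] at this
    exact (mul_eq_zero.1 this).resolve_left (num_ne_zero q k)
  induction j generalizing k k' j' with
  | zero =>
    rcases j' with _ | j'
    · rw [rowInner_zero_zero, haar_mon_eq_zero q (by omega), mul_zero, mul_zero]
    · rw [← conj_rowInner, right_zero, map_zero]
  | succ j ih =>
    rcases j' with _ | j'
    · exact right_zero _ _ _ _ _
    · have := rowInner_succ q k j i k' (j' + 1) i'
      rw [Nat.add_sub_cancel, ih (by omega) (by omega) (by omega), mul_zero] at this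
      exact (mul_eq_zero.1 this).resolve_left (num_ne_zero q k)

/-! ### Haar functional of the diagonal monomials and norms of the coefficients -/

theorem one_sub_pow_ne_zero {n : ℕ} (hn : n ≠ 0) : 1 - ((q : ℝ) : ℂ) ^ n ≠ 0 := by
  have : 1 - (q : ℝ) ^ n ≠ 0 := (sub_pos.2 (pow_lt_one₀ q.2.1.le q.2.2 hn)).ne'
  exact_mod_cast this

/-- c^n b^n multiplies e(r,0) by (-q)^n q^(2nr), so the Haar functional is a geometric series of
ratio q^(2n+2). -/
theorem haar_mon_zero_diag (n : ℕ) : (-((q : ℝ) : ℂ)⁻¹) ^ n * haar q (mon q 0 n n 0) =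
    (1 - ((q : ℝ) : ℂ) ^ 2) / (1 - ((q : ℝ) : ℂ) ^ (2 * n + 2)) := by
  have h0 := Param.ne_zero q
  have h : ∀ r : ℕ, ((q : ℝ) : ℂ) ^ (2 * r) * entry q (mon q 0 n n 0) (r, 0) (r, 0) =
      (-((q : ℝ) : ℂ)) ^ n * (((q : ℝ) : ℂ) ^ (2 * n + 2)) ^ r := by
    intro r
    rw [entry_mon, qprod, Finset.prod_range_zero, neg_pow ((q : ℝ) : ℂ)]
    ring
  have h1 : ‖((q : ℝ) : ℂ) ^ (2 * n + 2)‖ < 1 := by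
    rw [norm_pow, norm_q]
    exact pow_lt_one₀ q.2.1.le q.2.2 (by omega)
  have h2 : (-((q : ℝ) : ℂ)⁻¹) ^ n * (-((q : ℝ) : ℂ)) ^ n = 1 := by
    rw [← mul_pow, neg_mul_neg, inv_mul_cancel₀ h0, one_pow]
  rw [haar_apply]
  simp only [h]
  rw [tsum_mul_left, tsum_geometric_of_norm_lt_one h1, div_eq_mul_inv]
  linear_combination ((1 - ((q : ℝ) : ℂ) ^ 2) * (1 - ((q : ℝ) : ℂ) ^ (2 * n + 2))⁻¹) * h2

/-- `haar_deriv_aux` trades a pair `a`, `d` for a pair `c`, `b`. The Gaussian binomial absorbs the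
factors of the trade, so the normalized value depends on m + k alone and is read off at m = 0. -/
theorem haar_mon_diag (m k : ℕ) :
    gaussBinom ((q : ℝ) ^ 2)⁻¹ (m + k) k *
        ((-((q : ℝ) : ℂ)⁻¹) ^ k * haar q (mon q m k k m)) =
      (1 - ((q : ℝ) : ℂ) ^ 2) / (1 - ((q : ℝ) : ℂ) ^ (2 * (m + k) + 2)) := by
  have h0 := Param.ne_zero q
  induction m generalizing k with
  | zero =>
    rw [zero_add, gaussBinom_self (one_lt_inv_sq q), Complex.ofReal_one, one_mul,
      haar_mon_zero_diag]
  | succ m ih =>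
    have h1 := haar_deriv_aux q k m
    have h2 := gaussBinom_succ (one_lt_inv_sq q) (m + (k + 1)) k
    have hm := num_mul q m
    have hk := num_mul q k
    have hP := one_lt_inv_sq q
    rw [show m + 1 + k = m + (k + 1) by omega, ← ih (k + 1)]
    rw [show m + (k + 1) - k = m + 1 by omega] at h2
    have hn1 : (1 : ℂ) - ((((q : ℝ) ^ 2)⁻¹ : ℝ) : ℂ) ^ (k + 1) ≠ 0 := by
      exact_mod_cast (sub_neg.2 (one_lt_pow₀ hP k.succ_ne_zero)).ne
    replace h2 := congrArg (Complex.ofReal) h2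
    replace hm := congrArg (Complex.ofReal) hm
    replace hk := congrArg (Complex.ofReal) hk
    simp only [Complex.ofReal_mul, Complex.ofReal_sub, Complex.ofReal_one,
      Complex.ofReal_pow] at h2 hm hk
    -- Only polynomial relations between these quantities are needed from here on; P stands for q⁻².
    generalize (gaussBinom ((q : ℝ) ^ 2)⁻¹ (m + (k + 1)) (k + 1) : ℂ) = g1 at *
    generalize (gaussBinom ((q : ℝ) ^ 2)⁻¹ (m + (k + 1)) k : ℂ) = g0 at *
    generalize haar q (mon q m (k + 1) (k + 1) m) = H1 at *
    generalize haar q (mon q (m + 1) k k (m + 1)) = H0 at *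
    generalize ((((q : ℝ) ^ 2)⁻¹ : ℝ) : ℂ) = P at *
    generalize (num q (m + 1) : ℂ) = a at *
    generalize (num q (k + 1) : ℂ) = b at *
    generalize ((q : ℝ) : ℂ) = Q at *
    have e : Q⁻¹ ^ k * Q ^ k = 1 := by rw [← mul_pow, inv_mul_cancel₀ h0, one_pow]
    -- The relation `h1` with its q-numbers rewritten by `num_mul` and the common factor Q^m
    -- removed.
    have h3 : (1 - P ^ (m + 1)) * H1 + Q * (1 - P ^ (k + 1)) * H0 = 0 := by
      refine (mul_eq_zero.1 (?_ : Q ^ m * _ = 0)).resolve_left (pow_ne_zero _ h0)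
      linear_combination (1 - P) * h1 - H1 * hm - Q ^ (m + 1) * Q⁻¹ ^ k * H0 * hk -
        Q ^ (m + 1) * H0 * (1 - P ^ (k + 1)) * e
    refine mul_right_cancel₀ hn1 ?_
    have e' : Q⁻¹ * Q = 1 := inv_mul_cancel₀ h0
    linear_combination (-Q⁻¹) ^ k * (Q⁻¹ * g0 * h3 - g0 * H0 * (1 - P ^ (k + 1)) * e' + Q⁻¹ * H1 * h2)

/-- Each step of `rowInner_succ` contributes q² and a ratio of two factors 1 - q^(-2r), which is the
ratio of consecutive Gaussian binomials in j. The descent ends in column 0 at `haar_mon_diag`. -/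
theorem rowInner_self {k j i : ℕ} (hi : i ≤ k + j) :
    gaussBinom ((q : ℝ) ^ 2)⁻¹ (k + j) j * rowInner q k j i k j i =
      gaussBinom ((q : ℝ) ^ 2)⁻¹ (k + j) i * (((q : ℝ) : ℂ) ^ (2 * j) *
        ((1 - ((q : ℝ) : ℂ) ^ 2) / (1 - ((q : ℝ) : ℂ) ^ (2 * (k + j) + 2)))) := by
  have h0 := Param.ne_zero q
  induction j generalizing k with
  | zero =>
    obtain ⟨m, rfl⟩ := Nat.exists_eq_add_of_le' hi
    have := haar_mon_diag q m i
    rw [add_zero, rowInner_zero_zero, Nat.add_sub_cancel, mul_assoc, this]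
    simp [gaussBinom]
  | succ j ih =>
    have h1 := rowInner_succ q k j i k (j + 1) i
    have h2 := gaussBinom_succ (one_lt_inv_sq q) (k + (j + 1)) j
    have h3 := ih (k := k + 1) (by omega)
    have hk := num_mul q k
    have hj := num_mul q j
    have hP := one_lt_inv_sq q
    rw [Nat.add_sub_cancel] at h1
    rw [show k + (j + 1) - j = k + 1 by omega] at h2
    rw [show k + 1 + j = k + (j + 1) by omega] at h3
    have hn : (1 : ℂ) - ((((q : ℝ) ^ 2)⁻¹ : ℝ) : ℂ) ^ (j + 1) ≠ 0 := by
      exact_mod_cast (sub_neg.2 (one_lt_pow₀ hP j.succ_ne_zero)).ne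
    replace h2 := congrArg (Complex.ofReal) h2
    replace hk := congrArg (Complex.ofReal) hk
    replace hj := congrArg (Complex.ofReal) hj
    simp only [Complex.ofReal_mul, Complex.ofReal_sub, Complex.ofReal_one,
      Complex.ofReal_pow] at h2 hk hj
    generalize (1 - ((q : ℝ) : ℂ) ^ 2) / (1 - ((q : ℝ) : ℂ) ^ (2 * (k + (j + 1)) + 2)) = D at *
    generalize (gaussBinom ((q : ℝ) ^ 2)⁻¹ (k + (j + 1)) (j + 1) : ℂ) = g1 at *
    generalize (gaussBinom ((q : ℝ) ^ 2)⁻¹ (k + (j + 1)) j : ℂ) = g0 at *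
    generalize (gaussBinom ((q : ℝ) ^ 2)⁻¹ (k + (j + 1)) i : ℂ) = gi at *
    generalize rowInner q k (j + 1) i k (j + 1) i = I1 at *
    generalize rowInner q (k + 1) j i (k + 1) j i = I0 at *
    generalize ((((q : ℝ) ^ 2)⁻¹ : ℝ) : ℂ) = P at *
    generalize (num q (k + 1) : ℂ) = a at *
    generalize (num q (j + 1) : ℂ) = b at *
    generalize ((q : ℝ) : ℂ) = Q at *
    have e : Q⁻¹ ^ j * Q ^ j = 1 := by rw [← mul_pow, inv_mul_cancel₀ h0, one_pow]
    have h4 : (1 - P ^ (k + 1)) * I1 = Q ^ 2 * (1 - P ^ (j + 1)) * I0 := by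
      refine mul_left_cancel₀ (pow_ne_zero k h0) ?_
      linear_combination (1 - P) * h1 - I1 * hk + Q ^ (k + 2) * Q⁻¹ ^ j * I0 * hj +
        Q ^ (k + 2) * I0 * (1 - P ^ (j + 1)) * e
    refine mul_right_cancel₀ hn ?_
    linear_combination I1 * h2 + g0 * h4 + Q ^ 2 * (1 - P ^ (j + 1)) * h3

/-! ### Orthogonality relations for the matrix coefficients -/

theorem haar_matCoef_of_ne {n n' : ℕ} {i j : Fin (n + 1)} {i' j' : Fin (n' + 1)}
    (h : ¬ (n = n' ∧ (i : ℕ) = i' ∧ (j : ℕ) = j')) :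
    haar q (matCoef q n i j * star (matCoef q n' i' j')) = 0 := by
  have hj := j.2
  have hj' := j'.2
  have := rowInner_eq_zero q (k := n - j) (j := j) (i := i) (k' := n' - j') (j' := j') (i' := i')
    (by omega) (by omega) (by omega)
  rw [rowInner] at this
  rw [matCoef, matCoef, star_smul', smul_mul_smul_comm, map_smul, this, smul_zero]

/-- The squares of the normalizers are the two Gaussian binomials of `rowInner_self`, so they cancel
and the dependence on i disappears. -/
theorem haar_matCoef_self (n : ℕ) (i j : Fin (n + 1)) :
    haar q (matCoef q n i j * star (matCoef q n i j)) =
      ((q : ℝ) : ℂ) ^ (2 * (j : ℕ)) *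
        ((1 - ((q : ℝ) : ℂ) ^ 2) / (1 - ((q : ℝ) : ℂ) ^ (2 * n + 2))) := by
  have hj := Nat.lt_succ_iff.1 j.2
  have hi := Nat.lt_succ_iff.1 i.2
  have h := rowInner_self q (k := n - j) (j := j) (i := i) (by omega)
  rw [Nat.sub_add_cancel hj, rowInner] at h
  have hsq : ∀ k ≤ n, (normalizer q n k : ℂ) * normalizer q n k =
      gaussBinom ((q : ℝ) ^ 2)⁻¹ n k := by
    intro k hk
    rw [← Complex.ofReal_mul, normalizer, Real.mul_self_sqrt]
    exact (Real.sqrt_pos.1 (normalizer_pos q hk)).le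
  have hi0 : (normalizer q n i : ℂ) ≠ 0 := by exact_mod_cast (normalizer_pos q hi).ne'
  rw [← hsq _ hi, ← hsq _ hj] at h
  rw [matCoef, star_smul', Complex.conj_ofReal, smul_mul_smul_comm, map_smul, smul_eq_mul]
  refine mul_left_cancel₀ (mul_ne_zero hi0 hi0) ?_
  rw [← h]
  push_cast
  field_simp

/-- The leftover q^(-n) reflects the shift of column indices from {-l, …, l} to {0, …, n}: with it
the squared norm becomes q^(2(j-l))/[n+1]_q. -/
theorem qNumber_succ (n : ℕ) : qNumber q (n + 1) * ((1 - ((q : ℝ) : ℂ) ^ 2) /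
    (1 - ((q : ℝ) : ℂ) ^ (2 * n + 2))) = ((q : ℝ) : ℂ)⁻¹ ^ n := by
  have h0 := Param.ne_zero q
  have h1 := one_sub_pow_ne_zero q (n := 2 * n + 2) (by omega)
  have h2 := one_sub_pow_ne_zero q two_ne_zero
  have h3 : ((q : ℝ) : ℂ) - ((q : ℝ) : ℂ)⁻¹ ≠ 0 := by
    intro h
    apply h2
    have : ((q : ℝ) : ℂ) * ((q : ℝ) : ℂ)⁻¹ = 1 := mul_inv_cancel₀ h0
    linear_combination -((q : ℝ) : ℂ) * h - this
  rw [qNumber]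
  push_cast
  rw [div_mul_div_comm, div_eq_iff (mul_ne_zero h3 h1)]
  simp only [inv_pow]
  field_simp
  ring

end Orthogonality

/-! ### The eigenvectors -/

section Eigenvectors
variable {q : Param}

/-- The element `∑ₘ q^(-2m) t_{sm}` of the `s`-th row of `T^(l)`, `n = 2l`. -/
noncomputable def rowVector (q : Param) (n : ℕ) (s : Fin (n + 1)) : Coord q :=
  ∑ m : Fin (n + 1), ((q : ℝ) : ℂ) ^ ((n : ℤ) - 2 * (m : ℕ)) • matCoef q n s m

theorem fourier_rowVector_of_ne {n n' : ℕ} (h : n' ≠ n) (s : Fin (n + 1)) :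
    fourier q n' (toL2 q (rowVector q n s)) = 0 := by
  ext r r'
  rw [fourier_toL2, rowVector, Finset.sum_mul, map_sum]
  refine Finset.sum_eq_zero fun m _ => ?_
  rw [smul_mul_assoc, map_smul, haar_matCoef_of_ne q (by tauto), smul_zero]

/-- Orthogonality selects the summand m = r, whose weight q^(n-2r) is inverse to [n+1]_q times its
squared norm. The result does not depend on r: column s is constant, as needed to see the row sums
of σ. -/
theorem qNumber_mul_fourier_rowVector (n : ℕ) (s r s' : Fin (n + 1)) :
    qNumber q (n + 1) * fourier q n (toL2 q (rowVector q n s)) r s' = if s' = s then 1 else 0 := by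
  have h0 := Param.ne_zero q
  rw [fourier_toL2, rowVector, Finset.sum_mul, map_sum, Finset.sum_eq_single r]
  · rw [smul_mul_assoc, map_smul, smul_eq_mul]
    split_ifs with h
    · subst h
      rw [haar_matCoef_self]
      have hq := qNumber_succ q n
      have e : ((q : ℝ) : ℂ) ^ ((n : ℤ) - 2 * (r : ℕ)) * ((q : ℝ) : ℂ) ^ (2 * (r : ℕ)) *
          ((q : ℝ) : ℂ)⁻¹ ^ n = 1 := by
        rw [inv_pow, ← zpow_natCast, ← zpow_natCast, ← zpow_neg, ← zpow_add₀ h0, ← zpow_add₀ h0]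
        push_cast
        rw [show (n : ℤ) - 2 * (r : ℤ) + 2 * r + -n = 0 by ring, zpow_zero]
      linear_combination ((q : ℝ) : ℂ) ^ ((n : ℤ) - 2 * (r : ℕ)) *
        ((q : ℝ) : ℂ) ^ (2 * (r : ℕ)) * hq + e
    · rw [haar_matCoef_of_ne q (fun h' => h (Fin.ext h'.2.1).symm), mul_zero, mul_zero]
  · intro m _ hm
    rw [smul_mul_assoc, map_smul, haar_matCoef_of_ne q (fun h' => hm (Fin.ext h'.2.2)), smul_zero]
  · simp

theorem symbolTerm_rowVector_of_ne (σ : Symbol q) {n n' : ℕ} (h : n' ≠ n) (s : Fin (n + 1)) :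
    symbolTerm σ (toL2 q (rowVector q n s)) n' = 0 := by
  rw [symbolTerm, fourier_rowVector_of_ne h, Matrix.map_zero _ (map_zero _), Matrix.mul_zero,
    Matrix.zero_mul, map_zero, smul_zero, map_zero]

theorem qTrace_apply (n : ℕ) (A : Matrix (Fin (n + 1)) (Fin (n + 1)) (Coord q)) :
    qTrace q n A = ∑ j : Fin (n + 1), ((q : ℝ) : ℂ) ^ ((n : ℤ) - 2 * (j : ℕ)) • A j j := rfl

/-- A matrix applied to a constant column returns its row sums. Then Tr_q pairs the constant column
s with row s of T^(l), with weights q^(n-2j), which is v_s again. -/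
theorem symbolTerm_rowVector_self (σ : Symbol q) {n : ℕ} {z : ℂ}
    (hσ : ∀ i₀, ∑ j, σ n i₀ j = algebraMap ℂ (Coord q) z) (s : Fin (n + 1)) :
    symbolTerm σ (toL2 q (rowVector q n s)) n = z • toL2 q (rowVector q n s) := by
  rw [symbolTerm, ← map_smul (qTrace q n), ← map_smul (toL2 q) z]
  congr 1
  conv_rhs => rw [rowVector, Finset.smul_sum]
  -- The Fourier coefficients are central scalars, so they can be pulled out of the product with the
  -- entries of σ.
  have key : ∀ j s', qNumber q (n + 1) •
      (σ n * (fourier q n (toL2 q (rowVector q n s))).map (algebraMap ℂ (Coord q))) j s' =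
      if s' = s then algebraMap ℂ (Coord q) z else 0 := by
    intro j s'
    rw [Matrix.mul_apply, Finset.smul_sum]
    have : ∀ r, qNumber q (n + 1) • (σ n j r *
        (fourier q n (toL2 q (rowVector q n s))).map (algebraMap ℂ (Coord q)) r s') =
        if s' = s then σ n j r else 0 := by
      intro r
      rw [Matrix.map_apply, ← Algebra.commutes, ← Algebra.smul_def, smul_smul,
        qNumber_mul_fourier_rowVector]
      split_ifs <;> simp
    simp only [this]
    split_ifs
    · exact hσ j
    · simp
  rw [qTrace_apply]
  refine Finset.sum_congr rfl fun j _ => ?_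
  rw [smul_comm z]
  congr 1
  rw [Matrix.smul_apply, Matrix.mul_apply, Finset.smul_sum]
  simp only [← smul_mul_assoc, key, ite_mul, zero_mul, Finset.sum_ite_eq', Finset.mem_univ, if_true,
    Matrix.of_apply]
  rw [← Algebra.smul_def]

theorem rowVector_mem_pmapEigenspace (σ : Symbol q) {n : ℕ} {z : ℂ}
    (hσ : ∀ i₀, ∑ j, σ n i₀ j = algebraMap ℂ (Coord q) z) (s : Fin (n + 1)) :
    toL2 q (rowVector q n s) ∈ pmapEigenspace (psiDO σ) z := by
  have h : HasSum (symbolTerm σ (toL2 q (rowVector q n s))) (z • toL2 q (rowVector q n s)) := by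
    rw [← symbolTerm_rowVector_self σ hσ s]
    exact hasSum_single n fun n' hn => symbolTerm_rowVector_of_ne σ hn s
  exact (mem_pmapEigenspace _ _ _).2 ⟨h.summable, h.tsum_eq⟩

/-- The Fourier coefficient at (0, s), times [n+1]_q, reads off the coefficient of v_s; any row
index would serve in place of 0. Working with continuous functionals on the completion, no
faithfulness of h is needed. -/
theorem linearIndependent_rowVector (q : Param) (n : ℕ) :
    LinearIndependent ℂ fun s : Fin (n + 1) => toL2 q (rowVector q n s) := by
  rw [Fintype.linearIndependent_iff]
  intro g hg s
  have h := congrArg (fun f => qNumber q (n + 1) * fourier q n f 0 s) hg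
  simpa [Matrix.sum_apply, Finset.mul_sum, mul_left_comm, qNumber_mul_fourier_rowVector] using h

end Eigenvectors

/-! ### Eigenvalues, spectrum and multiplicity -/

theorem mem_pmapSpectrum_of_mem_pmapEigenspace {H : Type*} [NormedAddCommGroup H]
    [NormedSpace ℂ H] {T : H →ₗ.[ℂ] H} {z : ℂ} {f : H} (hf : f ∈ pmapEigenspace T z)
    (h0 : f ≠ 0) : z ∈ pmapSpectrum T := by
  rintro ⟨R, -, hR⟩
  obtain ⟨hd, hTf⟩ := (mem_pmapEigenspace T z f).1 hf
  have := hR ⟨f, hd⟩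
  rw [hTf, sub_self, map_zero] at this
  exact h0 this.symm

end SUq2

theorem mainTheorem7 (q : SUq2.Param) (lam : ℕ → ℂ) (σ : SUq2.Symbol q)
    (hσ : σ ∈ SUq2.symbolClass q 0)
    (hrow : ∀ (n : ℕ) (i₀ : Fin (n + 1)),
      ∑ j, σ n i₀ j = algebraMap ℂ (SUq2.Coord q) (lam n)) :
    Set.range lam ⊆ SUq2.pmapSpectrum (SUq2.psiDO σ) ∧
      ∀ n : ℕ, ((n + 1 : ℕ) : Cardinal) ≤
        Module.rank ℂ (SUq2.pmapEigenspace (SUq2.psiDO σ) (lam n)) := by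
  have hmem := fun n => SUq2.rowVector_mem_pmapEigenspace σ (hrow n)
  have hli := SUq2.linearIndependent_rowVector q
  constructor
  · rintro _ ⟨n, rfl⟩
    exact SUq2.mem_pmapSpectrum_of_mem_pmapEigenspace (hmem n 0) ((hli n).ne_zero 0)
  · intro n
    have : LinearIndependent ℂ fun s : Fin (n + 1) =>
        (⟨_, hmem n s⟩ : SUq2.pmapEigenspace (SUq2.psiDO σ) (lam n)) :=
      -- Independence is known in the Hilbert space and is pulled back along the inclusion of the
      -- eigenspace.
      LinearIndependent.of_comp (Submodule.subtype _) (hli n)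
    simpa using this.cardinal_le_rank
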